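/- **Notation.** For $m\in\mathbb{N}=\{1,2,\dots\}$, $\Phi_m$ is the class of real functions $\varphi$, continuous on $[0,\infty)$, such that $x\mapsto\varphi(\|x\|)$ is positive definite on $\mathbb{R}^m$ (a function on $\mathbb{R}$ is said to be in $\Phi_m$ if its restriction to $[0,\infty)$ is). $\mathcal{CM}$ is the set of completely monotone functions on $(0,\infty)$: the infinitely differentiable $f:(0,\infty)\to\mathbb{R}$ with $(-1)^kf^{(k)}(x)\ge 0$ for all $k\ge0$, $x>0$. For $\mu,\nu>0$ let $h_{\mu,\nu}(x)=0$ if $|x|\ge1$ and $$h_{\mu,\nu}(x)=\int_{|x|}^1(2u-|x|)\,g_{\mu,\nu}(u)\,g_{\mu,\nu}(u-|x|)\,du\quad(|x|<1),\qquad g_{\mu,\nu}(u)=u^{\mu-1}(1-u^2)^{\nu-1}.$$ Let $J_\lambda$ be the Bessel function of the first kind and $$j_\lambda(x)=\frac{J_\lambda(x)}{x^\lambda}=\frac1{2^\lambda}\sum_{k\ge0}\frac{1}{\Gamma(k+\lambda+1)}\frac{(-x^2/4)^k}{k!}.$$ For $t>0$ let $$\mathfrak{F}_m(h)(t)=\int_0^\infty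 h(u)\,u^{m-1}j_{\frac m2-1}(tu)\,du,\qquad I_{\delta,\mu,\nu,\alpha}(t)=\int_0^1(1-x^\delta)^{\mu-1}x^{\alpha}j_{\nu-\frac12}(tx)\,dx .$$ Let $\widehat h_{\mu,\nu}(t)=\int_{\mathbb{R}}e^{-itx}h_{\mu,\nu}(x)\,dx$ and $L(\varphi)(x)=\int_0^\infty e^{-tx}\varphi(t)\,dt$. **Proposition.** Let $\varepsilon>0$, $\mu>0$, $\nu>\frac12$, $\mu+\nu>1$, $m\in\mathbb{N}$, and put $n:=\frac{m-1}{2}+\nu$. For $\beta_1,\beta_2>0$ let $$f_{\mu,\nu,\varepsilon,\beta_1,\beta_2}(x)=\beta_2^{\varepsilon}h_{\mu,\nu}(x/\beta_2)-\beta_1^{\varepsilon}h_{\mu,\nu}(x/\beta_1),\quad x\in\mathbb{R}.$$ The following conditions are equivalent (and the equalities displayed in 3, 4 and 6 hold, where in 4 the derivative exists for every $t>0$, and in 6 the Laplace integral converges absolutely for every $x>0$): 1. $f_{\mu,\nu,\varepsilon,\beta_1,\beta_2}\in\Phi_m$ for all $\beta_2>\beta_1>0$. 2. For all $\beta_2>\beta_1>0$,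 the function $t\mapsto\beta_2^{\varepsilon+m}\mathfrak{F}_m(h_{\mu,\nu})(\beta_2t)-\beta_1^{\varepsilon+m}\mathfrak{F}_m(h_{\mu,\nu})(\beta_1t)$ is nonnegative on $(0,\infty)$. 3. The function $t^{\varepsilon+m}\mathfrak{F}_m(h_{\mu,\nu})(t)=2^{\nu-1}\Gamma(\nu)\,t^{\varepsilon+m}I_{1,\mu,\frac{m-1}2+\nu,m-1+2\nu-1}(t)$ is increasing (that is, nondecreasing) on $(0,\infty)$. 4. For all $t>0$, $$(\varepsilon+m)I_{1,\mu,\frac{m-1}2+\nu,m-1+2\nu-1}(t)+t\,I'_{1,\mu,\frac{m-1}2+\nu,m-1+2\nu-1}(t)=(\varepsilon+m)I_{1,\mu,\frac{m-1}2+\nu,m-1+2\nu-1}(t)-t^2I_{1,\mu,\frac{m-1}2+\nu+1,m-1+2\nu+1}(t)\ge0 .$$ 5. For all $t>0$, $\ (\varepsilon+m)\,\mathfrak{F}_1(h_{\mu,n})(t)-\dfrac{t^2}{2n}\,\mathfrak{F}_1(h_{\mu,n+1})(t)\ge0$. 6. $$L\Big(t^{2n+\mu-1}\Big((\varepsilon+m)\widehat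 h_{\mu,n}(t)-\frac{t^2}{2n}\widehat h_{\mu,n+1}(t)\Big)\Big)(x)=\Gamma(n)^2\,\Gamma(\mu)\,2^{2n-1}\Big(\frac{\varepsilon+m}{x^\mu(1+x^2)^n}-\frac{2n}{x^\mu(1+x^2)^{n+1}}\Big)\in\mathcal{CM}.$$ 7. $$\frac{\varepsilon-2\nu+1+(\varepsilon+m)x^2}{x^\mu(1+x^2)^{\frac{m-1}2+\nu+1}}\in\mathcal{CM}.$$ -/

import Mathlib

open MeasureTheory Set
open scoped ContDiff ComplexOrder ComplexConjugate

namespace Buhmann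

noncomputable section

/-- A function `f : E → ℂ` on an additive group is positive definite (in the sense of Bochner) if
`∑ i, ∑ j, c i * conj (c j) * f (x i - x j)` is real and nonnegative for all finite families of
points `x i` and complex coefficients `c i`. -/
def PosDefFun {E : Type*} [AddGroup E] (f : E → ℂ) : Prop :=
  ∀ (N : ℕ) (x : Fin N → E) (c : Fin N → ℂ),
    (0 : ℂ) ≤ ∑ i, ∑ j, c i * conj (c j) * f (x i - x j)

/-- The class `Φ_m` of functions `φ`, continuous on `[0,∞)`, such that `φ(‖·‖)` is positive
definite on `ℝ^m`. Only the values of `φ` on `[0,∞)` matter. -/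
def Phi (m : ℕ) (φ : ℝ → ℝ) : Prop :=
  ContinuousOn φ (Ici 0) ∧
    PosDefFun (fun x : EuclideanSpace ℝ (Fin m) => ((φ ‖x‖ : ℝ) : ℂ))

/-- Complete monotonicity on `(0,∞)`. Only the values of `f` on `(0,∞)` matter. -/
def CompletelyMonotone (f : ℝ → ℝ) : Prop :=
  ContDiffOn ℝ ∞ f (Ioi 0) ∧ ∀ (n : ℕ) (x : ℝ), 0 < x → 0 ≤ (-1 : ℝ) ^ n * iteratedDeriv n f x

/-- `g_{μ,ν}(u) = u^{μ-1} (1-u²)^{ν-1}`, for `u ∈ (0,1)`. -/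
def g (μ ν u : ℝ) : ℝ := u ^ (μ - 1) * (1 - u ^ 2) ^ (ν - 1)

/-- The function `h_{μ,ν}` (generalized Wendland function), supported in `[-1,1]`. -/
def h (μ ν x : ℝ) : ℝ :=
  if |x| < 1 then ∫ u in |x|..1, (2 * u - |x|) * g μ ν u * g μ ν (u - |x|) else 0

/-- The weighted difference
`f_{μ,ν,ε,β₁,β₂}(x) = β₂^ε h_{μ,ν}(x/β₂) - β₁^ε h_{μ,ν}(x/β₁)`. -/
def f (μ ν ε β₁ β₂ x : ℝ) : ℝ :=
  β₂ ^ ε * h μ ν (x / β₂) - β₁ ^ ε * h μ ν (x / β₁)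

/-- The normalized Bessel function `j_λ(x) = J_λ(x) / x^λ`, `J_λ` being the Bessel function of the
first kind, given by its everywhere convergent power series. -/
def besselj (l x : ℝ) : ℝ :=
  1 / 2 ^ l * ∑' k : ℕ, 1 / Real.Gamma (k + l + 1) * ((-(x ^ 2) / 4) ^ k / (k.factorial : ℝ))

/-- The Hankel transform
`𝔉_m(φ)(t) = t^{1-m/2} ∫_0^∞ φ(u) u^{m/2} J_{m/2-1}(tu) du = ∫_0^∞ φ(u) u^{m-1} j_{m/2-1}(tu) du`. -/
def hankel (m : ℝ) (φ : ℝ → ℝ) (t : ℝ) : ℝ :=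
  ∫ u in Ioi (0 : ℝ), φ u * u ^ (m - 1) * besselj (m / 2 - 1) (t * u)

/-- `I_{δ,μ,ν,α}(t) = ∫_0^1 (1-x^δ)^{μ-1} x^α j_{ν-1/2}(tx) dx`. -/
def I (δ μ ν α t : ℝ) : ℝ :=
  ∫ x in (0 : ℝ)..1, (1 - x ^ δ) ^ (μ - 1) * x ^ α * besselj (ν - 1 / 2) (t * x)

/-- The Fourier transform `∫_ℝ e^{-itx} h_{μ,ν}(x) dx` of `h_{μ,ν}`; it is real since `h_{μ,ν}` is
real and even, so that taking the real part loses nothing. -/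
def hHat (μ ν t : ℝ) : ℝ :=
  (∫ x : ℝ, Complex.exp (-(Complex.I * t * x)) * (h μ ν x : ℂ)).re

/-- The Laplace transform `∫_0^∞ e^{-tx} φ(t) dt`. -/
def laplace (φ : ℝ → ℝ) (x : ℝ) : ℝ :=
  ∫ t in Ioi (0 : ℝ), Real.exp (-(t * x)) * φ t

end

end Buhmann

/-! The theorem holds because each condition is a reformulation of the nonnegativity of one function
of `t`, the combination `(ε + m) I - t² I₊`, where `I = I 1 μ n (2n - 1)` and
`I₊ = I 1 μ (n + 1) (2n + 1)`.

*The function `h`.* The substitution `s = 1 - u (u - x)` in its definition shows that for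
`0 ≤ x < 1` the value `h μ ν x` is the integral of `(1 - s)^(μ-1) (s² - x²)^(ν-1)` over `(x, 1)`, a
mixture of truncated powers (`h_eq_integral`). So `h` is continuous with compact support
(`continuous_h`; this is where `ν > 1/2` and `μ + ν > 1` enter), and its moments are products of two
Beta integrals (`integral_h_mul_rpow`). Integrating the Bessel series termwise, the Hankel transform
of `h` and a multiple of `I` have the same power series (`hankel_h_eq`). The identity
`j_λ'(x) = -x j_{λ+1}(x)` gives `I' = -t I₊` (`hasDerivAt_I`).

*Positive definiteness.* For a continuous radial function of compact support, positive definiteness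
on `ℝ^m` is nonnegativity of the Hankel transform (`phi_iff_hankel_nonneg`). The Fourier transform
of a radial function is a Hankel transform because that of the surface measure of the sphere is a
normalized Bessel function, which follows from the Gaussian moments (`integral_toSphere_cos_inner`).
One direction of Bochner's theorem comes from averaging the quadratic form over independent random
points of a large ball (`integral_nonneg_of_sum_sub_nonneg`), the other from Gaussian summability of
the inversion formula (`posDefFun_of_fourier_nonneg`). For differences of dilates of `h` the
resulting inequality says that `t^(ε+m) 𝔉_m(h)(t)` is nondecreasing
(`forall_dilate_le_iff_monotoneOn`), and differentiating yields the combination above.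

*Complete monotonicity.* By `hankel_h_eq` in dimension one, where `j_{-1/2}` is a multiple of the
cosine, the combination is also a positive multiple of `(ε + m) ĥ_{μ,n} - t²/(2n) ĥ_{μ,n+1}`.
The Laplace transform of a continuous function of polynomial growth is completely monotone exactly when the
function is nonnegative: differentiate under the integral sign (`completelyMonotone_laplace_iff`)
and apply Post's inversion formula (`nonneg_of_laplace_moments_nonneg`). Finally, the weight
`t^(2n+μ-1)` cancels the Gamma functions in the power series of `ĥ`, so that the Laplace transform
is summed by the binomial series for `x > 1` and extended to `x > 0` by the identity theorem
(`laplace_rpow_mul_hHat`). -/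

namespace Buhmann

open Filter Topology

/-! ### Beta integrals -/

lemma integrableOn_beta {a b : ℝ} (ha : 0 < a) (hb : 0 < b) :
    IntegrableOn (fun x : ℝ => x ^ (a - 1) * (1 - x) ^ (b - 1)) (Ioo 0 1) := by
  have H := Complex.betaIntegral_convergent (u := a) (v := b) (by simpa) (by simpa)
  rw [intervalIntegrable_iff_integrableOn_Ioo_of_le zero_le_one] at H
  refine H.re.congr ((ae_restrict_mem measurableSet_Ioo).mono fun x hx => ?_)
  have h1 : (x : ℂ) ^ ((a : ℂ) - 1) = ((x ^ (a - 1) : ℝ) : ℂ) := by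
    rw [Complex.ofReal_cpow hx.1.le]; push_cast; rfl
  have h2 : (1 - x : ℂ) ^ ((b : ℂ) - 1) = (((1 - x) ^ (b - 1) : ℝ) : ℂ) := by
    rw [Complex.ofReal_cpow (by linarith [hx.2])]; push_cast; rfl
  simp only [h1, h2, ← Complex.ofReal_mul]
  simp

lemma integral_beta {a b : ℝ} (ha : 0 < a) (hb : 0 < b) :
    ∫ x in Ioo (0 : ℝ) 1, x ^ (a - 1) * (1 - x) ^ (b - 1) =
      Real.Gamma a * Real.Gamma b / Real.Gamma (a + b) := by
  have H := ProbabilityTheory.beta_eq_betaIntegralReal a b ha hb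
  rw [ProbabilityTheory.beta] at H
  rw [H, Complex.betaIntegral, intervalIntegral.integral_of_le zero_le_one,
    integral_Ioc_eq_integral_Ioo]
  have : ∀ x ∈ Ioo (0 : ℝ) 1, (x : ℂ) ^ ((a : ℂ) - 1) * (1 - x : ℂ) ^ ((b : ℂ) - 1) =
      ((x ^ (a - 1) * (1 - x) ^ (b - 1) : ℝ) : ℂ) := by
    intro x hx
    have h1 : (x : ℂ) ^ ((a : ℂ) - 1) = ((x ^ (a - 1) : ℝ) : ℂ) := by
      rw [Complex.ofReal_cpow hx.1.le]; push_cast; rfl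
    have h2 : (1 - x : ℂ) ^ ((b : ℂ) - 1) = (((1 - x) ^ (b - 1) : ℝ) : ℂ) := by
      rw [Complex.ofReal_cpow (by linarith [hx.2])]; push_cast; rfl
    rw [h1, h2, Complex.ofReal_mul]
  rw [setIntegral_congr_fun measurableSet_Ioo this, integral_complex_ofReal, Complex.ofReal_re]

/-! ### Truncated powers and the moments of `h` -/

/-- The substitution `s = 1 - u (u - x)` turns the defining integral of `h` into a mixture of the
truncated powers `(s² - x²)₊^{ν-1}`. -/
lemma h_eq_integral (μ ν : ℝ) {x : ℝ} (hx0 : 0 ≤ x) (hx1 : x < 1) :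
    h μ ν x = ∫ s in Ioo x 1, (1 - s) ^ (μ - 1) * (s ^ 2 - x ^ 2) ^ (ν - 1) := by
  have himg : (fun u : ℝ => 1 - u * (u - x)) '' Ioo x 1 = Ioo x 1 := by
    apply Subset.antisymm
    · rintro _ ⟨u, ⟨hu1, hu2⟩, rfl⟩
      constructor <;> simp only <;> nlinarith
    · intro s hs
      have hc : ContinuousOn (fun u : ℝ => 1 - u * (u - x)) (Icc x 1) := by fun_prop
      have := intermediate_value_Ioo' hx1.le hc
      simp only [sub_self, mul_zero, sub_zero, one_mul, sub_sub_cancel] at this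
      exact this hs
  have hder : ∀ u ∈ Ioo x 1, HasDerivWithinAt (fun u : ℝ => 1 - u * (u - x)) (-(2 * u - x))
      (Ioo x 1) u := by
    intro u _
    have := ((hasDerivAt_id u).mul ((hasDerivAt_id u).sub_const x)).const_sub 1
    convert! this.hasDerivWithinAt using 1
    simp; ring
  have hinj : InjOn (fun u : ℝ => 1 - u * (u - x)) (Ioo x 1) := by
    intro a ha b hb hab
    simp only at hab
    have : (a - b) * (a + b - x) = 0 := by linarith
    rcases mul_eq_zero.1 this with h' | h'
    · linarith
    · linarith [ha.1, hb.1]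
  have key := integral_image_eq_integral_abs_deriv_smul measurableSet_Ioo hder hinj
    (fun s => (1 - s) ^ (μ - 1) * (s ^ 2 - x ^ 2) ^ (ν - 1))
  rw [himg] at key
  rw [key, h, abs_of_nonneg hx0, if_pos hx1, intervalIntegral.integral_of_le hx1.le,
    integral_Ioc_eq_integral_Ioo]
  refine setIntegral_congr_fun measurableSet_Ioo fun u hu => ?_
  have hu0 : 0 < u := hx0.trans_lt hu.1
  have h1 : 0 < u - x := by linarith [hu.1]
  have h2 : 0 < 1 - u ^ 2 := by nlinarith [hu.2]
  have h3 : 0 < 1 - (u - x) ^ 2 := by nlinarith [hu.2]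
  simp only [g, abs_neg, smul_eq_mul]
  rw [abs_of_nonneg (by linarith),
    show 1 - (1 - u * (u - x)) = u * (u - x) by ring,
    show (1 - u * (u - x)) ^ 2 - x ^ 2 = (1 - u ^ 2) * (1 - (u - x) ^ 2) by ring,
    Real.mul_rpow hu0.le h1.le, Real.mul_rpow h2.le h3.le]
  ring

/-- Rescaling the interval `(x,1)` to `(0,1)` isolates the behaviour of `h` at `x = 1`. -/
lemma h_eq_rpow_mul_integral (μ ν : ℝ) {x : ℝ} (hx0 : 0 ≤ x) (hx1 : x < 1) :
    h μ ν x = (1 - x) ^ (μ + ν - 1) * ∫ t in Ioo (0 : ℝ) 1,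
      t ^ (ν - 1) * (1 - t) ^ (μ - 1) * (2 * x + (1 - x) * t) ^ (ν - 1) := by
  have hd : 0 < 1 - x := by linarith
  have himg : (fun t : ℝ => x + (1 - x) * t) '' Ioo 0 1 = Ioo x 1 := by
    ext s
    constructor
    · rintro ⟨t, ⟨ht0, ht1⟩, rfl⟩
      constructor <;> simp only <;> nlinarith
    · rintro ⟨hs0, hs1⟩
      refine ⟨(s - x) / (1 - x), ⟨div_pos (by linarith) hd, ?_⟩, ?_⟩
      · rw [div_lt_one hd]; linarith
      · simp only; field_simp; ring
  have hder : ∀ t ∈ Ioo (0 : ℝ) 1, HasDerivWithinAt (fun t : ℝ => x + (1 - x) * t) (1 - x)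
      (Ioo 0 1) t := by
    intro t _
    have := ((hasDerivAt_id t).const_mul (1 - x)).const_add x
    simpa using this.hasDerivWithinAt
  have hinj : InjOn (fun t : ℝ => x + (1 - x) * t) (Ioo 0 1) := by
    intro a _ b _ hab
    simp only [add_right_inj] at hab
    exact mul_left_cancel₀ hd.ne' hab
  have key := integral_image_eq_integral_abs_deriv_smul measurableSet_Ioo hder hinj
    (fun s => (1 - s) ^ (μ - 1) * (s ^ 2 - x ^ 2) ^ (ν - 1))
  rw [himg] at key
  rw [h_eq_integral μ ν hx0 hx1, key, ← integral_const_mul]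
  refine setIntegral_congr_fun measurableSet_Ioo fun t ht => ?_
  have h1 : 0 < 1 - t := by linarith [ht.2]
  have h2 : 0 < 2 * x + (1 - x) * t := by nlinarith [ht.1]
  simp only [smul_eq_mul]
  rw [abs_of_pos hd, show 1 - (x + (1 - x) * t) = (1 - x) * (1 - t) by ring,
    show (x + (1 - x) * t) ^ 2 - x ^ 2 = (1 - x) * (t * (2 * x + (1 - x) * t)) by ring,
    Real.mul_rpow hd.le h1.le, Real.mul_rpow hd.le (mul_pos ht.1 h2).le,
    Real.mul_rpow ht.1.le h2.le,
    show μ + ν - 1 = 1 + (μ - 1) + (ν - 1) by ring, Real.rpow_add hd, Real.rpow_add hd,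
    Real.rpow_one]
  ring

lemma h_of_one_le (μ ν : ℝ) {x : ℝ} (hx : 1 ≤ x) : h μ ν x = 0 := by
  rw [h, if_neg]
  rw [abs_of_nonneg (by linarith)]
  linarith

lemma h_abs (μ ν x : ℝ) : h μ ν |x| = h μ ν x := by
  simp [h]

/-- The only delicate point of `[0,1)` is `x = 0` when `ν < 1`, where the rescaled integrand is of the
order `t ^ (2 * ν - 2)`; this is integrable since `ν > 1/2`. -/
lemma continuousOn_h {μ ν : ℝ} (hμ : 0 < μ) (hν : 1 / 2 < ν) (hμν : 1 < μ + ν) :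
    ContinuousOn (h μ ν) (Ici 0) := by
  -- the formula that holds on `[0,1)` also gives the value `0` at `1`
  have hcont : ContinuousOn (fun x : ℝ => ∫ t in Ioo (0 : ℝ) 1,
      t ^ (ν - 1) * (1 - t) ^ (μ - 1) * (2 * x + (1 - x) * t) ^ (ν - 1)) (Icc 0 1) := by
    apply continuousOn_of_dominated (bound := fun t => 2 ^ (ν - 1) * (t ^ (ν - 1) *
      (1 - t) ^ (μ - 1)) + t ^ ((2 * ν - 1) - 1) * (1 - t) ^ (μ - 1))
    · intro x _
      apply Measurable.aestronglyMeasurable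
      fun_prop
    · intro x hx
      refine (ae_restrict_mem measurableSet_Ioo).mono fun t ht => ?_
      have h1 : 0 < 1 - t := by linarith [ht.2]
      have h2 : t ≤ 2 * x + (1 - x) * t := by nlinarith [ht.1, hx.1, hx.2, ht.2]
      have h2' : 0 < 2 * x + (1 - x) * t := ht.1.trans_le h2
      have h3 : 2 * x + (1 - x) * t ≤ 2 := by nlinarith [ht.1, hx.1, hx.2, ht.2]
      have h4 : (2 * x + (1 - x) * t) ^ (ν - 1) ≤ 2 ^ (ν - 1) + t ^ (ν - 1) := by
        rcases le_total 1 ν with hv | hv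
        · have := Real.rpow_le_rpow h2'.le h3 (by linarith : 0 ≤ ν - 1)
          have := Real.rpow_nonneg ht.1.le (ν - 1)
          linarith
        · have := Real.rpow_le_rpow_of_nonpos ht.1 h2 (by linarith : ν - 1 ≤ 0)
          have := Real.rpow_nonneg (zero_le_two (α := ℝ)) (ν - 1)
          linarith
      have h5 : 0 ≤ t ^ (ν - 1) * (1 - t) ^ (μ - 1) :=
        mul_nonneg (Real.rpow_nonneg ht.1.le _) (Real.rpow_nonneg h1.le _)
      rw [Real.norm_of_nonneg (mul_nonneg h5 (Real.rpow_nonneg h2'.le _))]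
      calc _ ≤ t ^ (ν - 1) * (1 - t) ^ (μ - 1) * (2 ^ (ν - 1) + t ^ (ν - 1)) := by gcongr
        _ = _ := by
          rw [show (2 * ν - 1) - 1 = (ν - 1) + (ν - 1) by ring, Real.rpow_add ht.1]
          ring
    · exact ((integrableOn_beta (by linarith) hμ).const_mul _).add
        (integrableOn_beta (a := 2 * ν - 1) (by linarith) hμ)
    · refine (ae_restrict_mem measurableSet_Ioo).mono fun t ht x hx => ?_
      have h2 : t ≤ 2 * x + (1 - x) * t := by nlinarith [ht.1, hx.1, hx.2, ht.2]
      apply ContinuousAt.continuousWithinAt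
      apply ContinuousAt.mul continuousAt_const
      apply ContinuousAt.rpow_const (by fun_prop)
      left
      linarith [ht.1]
  have hIcc : ContinuousOn (h μ ν) (Icc 0 1) := by
    have hp : ContinuousOn (fun x : ℝ => (1 - x) ^ (μ + ν - 1)) (Icc 0 1) := by
      apply ContinuousOn.rpow_const (by fun_prop)
      intro x _
      right; linarith
    refine (hp.mul hcont).congr fun x hx => ?_
    rcases hx.2.lt_or_eq with h1 | h1
    · exact h_eq_rpow_mul_integral μ ν hx.1 h1
    · rw [h_of_one_le μ ν h1.ge, h1]
      simp [Real.zero_rpow (by linarith : μ + ν - 1 ≠ 0)]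
  have hIci : ContinuousOn (h μ ν) (Ici 1) :=
    continuousOn_const.congr fun x hx => h_of_one_le μ ν hx
  rw [← Icc_union_Ici_eq_Ici zero_le_one]
  exact hIcc.union_of_isClosed hIci isClosed_Icc isClosed_Ici

lemma continuous_h {μ ν : ℝ} (hμ : 0 < μ) (hν : 1 / 2 < ν) (hμν : 1 < μ + ν) :
    Continuous (h μ ν) := by
  rw [← funext (h_abs μ ν)]
  exact (continuousOn_h hμ hν hμν).comp_continuous continuous_abs fun x => abs_nonneg x

lemma hasCompactSupport_h (μ ν : ℝ) : HasCompactSupport (h μ ν) := by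
  apply HasCompactSupport.of_support_subset_isCompact (isCompact_Icc (a := (-1 : ℝ)) (b := 1))
  intro x hx
  by_contra hx'
  apply hx
  rw [← h_abs]
  apply h_of_one_le
  by_contra! hc
  exact hx' ⟨(abs_lt.1 hc).1.le, (abs_lt.1 hc).2.le⟩

lemma integrable_h {μ ν : ℝ} (hμ : 0 < μ) (hν : 1 / 2 < ν) (hμν : 1 < μ + ν) :
    Integrable (h μ ν) :=
  (continuous_h hμ hν hμν).integrable_of_hasCompactSupport (hasCompactSupport_h μ ν)

lemma integral_Ioi_mul_h (μ ν : ℝ) (w : ℝ → ℝ) :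
    ∫ x in Ioi (0 : ℝ), h μ ν x * w x = ∫ x in Ioo (0 : ℝ) 1, h μ ν x * w x := by
  apply setIntegral_eq_of_subset_of_forall_sdiff_eq_zero measurableSet_Ioi Ioo_subset_Ioi_self
  rintro x ⟨hx0, hx1⟩
  rw [h_of_one_le, zero_mul]
  by_contra! hc
  exact hx1 ⟨hx0, hc⟩

/-- The moments of a truncated power, by the substitution `y = (x/s)²`. -/
lemma truncated_power_moment {ν p s : ℝ} (hν : 0 < ν) (hp : -1 < p) (hs : 0 < s) :
    IntegrableOn (fun x : ℝ => (s ^ 2 - x ^ 2) ^ (ν - 1) * x ^ p) (Ioo 0 s) ∧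
    ∫ x in Ioo 0 s, (s ^ 2 - x ^ 2) ^ (ν - 1) * x ^ p =
      s ^ (2 * ν + p - 1) * (Real.Gamma ν * Real.Gamma ((p + 1) / 2) /
        Real.Gamma (ν + (p + 1) / 2) / 2) := by
  have himg : (fun x : ℝ => (x / s) ^ 2) '' Ioo 0 s = Ioo 0 1 := by
    apply Subset.antisymm
    · rintro _ ⟨u, ⟨hu1, hu2⟩, rfl⟩
      have h1 : 0 < u / s := by positivity
      have h2 : u / s < 1 := by rwa [div_lt_one hs]
      exact ⟨by positivity, by simp only; nlinarith⟩
    · intro y hy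
      have hc : ContinuousOn (fun x : ℝ => (x / s) ^ 2) (Icc 0 s) := by fun_prop
      have := intermediate_value_Ioo hs.le hc
      simp only [zero_div, div_self hs.ne', one_pow, ne_eq, OfNat.ofNat_ne_zero,
        not_false_eq_true, zero_pow] at this
      exact this hy
  have hder : ∀ x ∈ Ioo 0 s, HasDerivWithinAt (fun x : ℝ => (x / s) ^ 2) (2 * (x / s) / s)
      (Ioo 0 s) x := by
    intro x _
    have := ((hasDerivAt_id x).div_const s).pow 2
    convert! this.hasDerivWithinAt using 1
    simp; ring
  have hinj : InjOn (fun x : ℝ => (x / s) ^ 2) (Ioo 0 s) := by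
    intro a ha b hb hab
    simp only at hab
    have h1 := (pow_left_inj₀ (div_pos ha.1 hs).le (div_pos hb.1 hs).le two_ne_zero).1 hab
    exact (div_left_inj' hs.ne').1 h1
  have hpt : ∀ x ∈ Ioo 0 s, |2 * (x / s) / s| • (((x / s) ^ 2) ^ ((p + 1) / 2 - 1) *
      (1 - (x / s) ^ 2) ^ (ν - 1)) =
      (2 * s ^ (-(2 * ν + p - 1))) * ((s ^ 2 - x ^ 2) ^ (ν - 1) * x ^ p) := by
    intro x hx
    have hx0 := hx.1
    have h1 : 0 < s ^ 2 - x ^ 2 := by nlinarith [hx.2]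
    rw [abs_of_pos (by positivity), smul_eq_mul,
      show 1 - (x / s) ^ 2 = (s ^ 2 - x ^ 2) / s ^ 2 by field_simp,
      Real.div_rpow h1.le (by positivity), ← Real.rpow_natCast (x / s) 2,
      ← Real.rpow_mul (by positivity), Real.div_rpow hx0.le hs.le, ← Real.rpow_natCast s 2,
      ← Real.rpow_mul hs.le]
    have e1 : x ^ p = x * x ^ (p - 1) := by
      conv_lhs => rw [show p = 1 + (p - 1) by ring, Real.rpow_add hx0, Real.rpow_one]
    have e2 : ((2 : ℕ) : ℝ) * ((p + 1) / 2 - 1) = p - 1 := by push_cast; ring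
    have e3 : s ^ (-(2 * ν + p - 1)) = s ^ (-(2 : ℝ)) * (s ^ (p - 1))⁻¹ *
        (s ^ (((2 : ℕ) : ℝ) * (ν - 1)))⁻¹ := by
      rw [← Real.rpow_neg hs.le, ← Real.rpow_neg hs.le, ← Real.rpow_add hs, ← Real.rpow_add hs]
      congr 1; push_cast; ring
    rw [e1, e2, e3, Real.rpow_neg hs.le, Real.rpow_two, Real.rpow_natCast]
    field_simp
  have hne : 2 * s ^ (-(2 * ν + p - 1)) ≠ 0 := by positivity
  have hp' : 0 < (p + 1) / 2 := by linarith
  constructor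
  · have := (integrableOn_image_iff_integrableOn_abs_deriv_smul measurableSet_Ioo hder hinj
      (fun y => y ^ ((p + 1) / 2 - 1) * (1 - y) ^ (ν - 1))).1
      (by rw [himg]; exact integrableOn_beta hp' hν)
    rw [integrableOn_congr_fun hpt measurableSet_Ioo] at this
    exact (integrable_const_mul_iff (isUnit_iff_ne_zero.2 hne) _).1 this
  · have key := integral_image_eq_integral_abs_deriv_smul measurableSet_Ioo hder hinj
      (fun y => y ^ ((p + 1) / 2 - 1) * (1 - y) ^ (ν - 1))
    rw [himg, setIntegral_congr_fun measurableSet_Ioo hpt, integral_const_mul,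
      integral_beta hp' hν, Real.rpow_neg hs.le] at key
    have hs' : s ^ (2 * ν + p - 1) ≠ 0 := by positivity
    rw [mul_comm (Real.Gamma ν), add_comm ν, key]
    field_simp

/-- The moments of `h`: a product of two Beta integrals, by Tonelli's theorem. -/
lemma integral_h_mul_rpow {μ ν p : ℝ} (hμ : 0 < μ) (hν : 1 / 2 < ν) (hp : 0 ≤ p) :
    ∫ x in Ioo (0 : ℝ) 1, h μ ν x * x ^ p =
      Real.Gamma (2 * ν + p) * Real.Gamma μ / Real.Gamma (2 * ν + p + μ) *
      (Real.Gamma ν * Real.Gamma ((p + 1) / 2) / Real.Gamma (ν + (p + 1) / 2) / 2) := by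
  set C := Real.Gamma ν * Real.Gamma ((p + 1) / 2) / Real.Gamma (ν + (p + 1) / 2) / 2 with hC
  -- the joint integrand, supported on the triangle `0 < x < s < 1`
  let F : ℝ → ℝ → ℝ := fun x s => (Ioo x 1).indicator
    (fun s => (1 - s) ^ (μ - 1) * (s ^ 2 - x ^ 2) ^ (ν - 1) * x ^ p) s
  have hFeq : ∀ s ∈ Ioo (0 : ℝ) 1, (fun x => F x s) =
      (Iio s).indicator (fun x => (1 - s) ^ (μ - 1) * ((s ^ 2 - x ^ 2) ^ (ν - 1) * x ^ p)) := by
    intro s hs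
    ext x
    by_cases hx : x < s
    · simp [F, indicator, hx, hs.2, mul_assoc]
    · simp [F, indicator, hx]
  have hset : ∀ s ∈ Ioo (0 : ℝ) 1, Iio s ∩ Ioo 0 1 = Ioo 0 s := by
    intro s hs
    ext x
    simp only [mem_inter_iff, mem_Iio, mem_Ioo]
    exact ⟨fun h => ⟨h.2.1, h.1⟩, fun h => ⟨h.2, h.1, h.2.trans hs.2⟩⟩
  have hFnn : ∀ x ∈ Ioo (0 : ℝ) 1, ∀ s, 0 ≤ F x s := by
    intro x hx s
    apply indicator_nonneg
    intro s hs
    have h1 : 0 ≤ 1 - s := by linarith [hs.2]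
    have h2 : 0 ≤ s ^ 2 - x ^ 2 := by nlinarith [hs.1, hx.1]
    have h3 := hx.1.le
    positivity
  have hFmeas : Measurable (Function.uncurry F) := by
    have : Function.uncurry F = {q : ℝ × ℝ | q.1 < q.2 ∧ q.2 < 1}.indicator
        (fun q => (1 - q.2) ^ (μ - 1) * (q.2 ^ 2 - q.1 ^ 2) ^ (ν - 1) * q.1 ^ p) := by
      ext ⟨x, s⟩
      simp [F, indicator, Function.uncurry]
    rw [this]
    apply Measurable.indicator (by fun_prop)
    exact (measurableSet_lt measurable_fst measurable_snd).inter
      (measurableSet_lt measurable_snd measurable_const)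
  have hin : ∀ s ∈ Ioo (0 : ℝ) 1, IntegrableOn (fun x => F x s) (Ioo 0 1) := by
    intro s hs
    rw [hFeq s hs, IntegrableOn, integrable_indicator_iff measurableSet_Iio, IntegrableOn,
      Measure.restrict_restrict measurableSet_Iio, hset s hs]
    exact (truncated_power_moment (by linarith) (by linarith) hs.1).1.const_mul _
  have hval : ∀ s ∈ Ioo (0 : ℝ) 1, ∫ x in Ioo (0 : ℝ) 1, F x s =
      C * (s ^ ((2 * ν + p) - 1) * (1 - s) ^ (μ - 1)) := by
    intro s hs
    rw [hFeq s hs, integral_indicator measurableSet_Iio,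
      Measure.restrict_restrict measurableSet_Iio, hset s hs, integral_const_mul,
      (truncated_power_moment (by linarith) (by linarith) hs.1).2]
    ring
  have hint : Integrable (Function.uncurry F)
      ((volume.restrict (Ioo (0 : ℝ) 1)).prod (volume.restrict (Ioo (0 : ℝ) 1))) := by
    rw [integrable_prod_iff' hFmeas.aestronglyMeasurable]
    refine ⟨(ae_restrict_mem measurableSet_Ioo).mono fun s hs => hin s hs, ?_⟩
    refine ((integrableOn_beta (a := 2 * ν + p) (by linarith) hμ).const_mul C).congr ?_
    refine (ae_restrict_mem measurableSet_Ioo).mono fun s hs => ?_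
    simp only
    rw [← hval s hs]
    refine setIntegral_congr_fun measurableSet_Ioo fun x hx => ?_
    exact (Real.norm_of_nonneg (hFnn x hx s)).symm
  have hswap := integral_integral_swap hint
  rw [setIntegral_congr_fun measurableSet_Ioo hval, integral_const_mul,
    integral_beta (by linarith) hμ] at hswap
  rw [mul_comm, ← hswap]
  refine setIntegral_congr_fun measurableSet_Ioo fun x hx => ?_
  simp only [F]
  rw [integral_indicator measurableSet_Ioo, Measure.restrict_restrict measurableSet_Ioo,
    inter_eq_left.2 (Ioo_subset_Ioo_left hx.1.le), integral_mul_const,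
    ← h_eq_integral _ _ hx.1.le hx.2]

/-! ### The normalized Bessel function -/

/-- The coefficient of `x ^ (2 * k)` in the power series of `besselj l`. -/
noncomputable def besselCoeff (l : ℝ) (k : ℕ) : ℝ :=
  1 / 2 ^ l * (1 / Real.Gamma (k + l + 1) * ((-1 / 4) ^ k / (k.factorial : ℝ)))

lemma Gamma_nat_add_pos {l : ℝ} (hl : -1 < l) (k : ℕ) : 0 < Real.Gamma (k + l + 1) := by
  apply Real.Gamma_pos_of_pos
  have : (0 : ℝ) ≤ k := k.cast_nonneg
  linarith

lemma besselCoeff_ne_zero {l : ℝ} (hl : -1 < l) (k : ℕ) : besselCoeff l k ≠ 0 := by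
  have h1 := (Gamma_nat_add_pos hl k).ne'
  have h2 : (2 : ℝ) ^ l ≠ 0 := by positivity
  have h3 : (k.factorial : ℝ) ≠ 0 := by positivity
  unfold besselCoeff
  have h4 : ((-1 / 4 : ℝ)) ^ k ≠ 0 := pow_ne_zero _ (by norm_num)
  positivity

lemma besselCoeff_succ {l : ℝ} (hl : -1 < l) (k : ℕ) :
    besselCoeff l (k + 1) = besselCoeff l k * (-1 / 4 / ((k + l + 1) * (k + 1))) := by
  have h0 : (0 : ℝ) < k + l + 1 := by
    have : (0 : ℝ) ≤ k := k.cast_nonneg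
    linarith
  have h1 := (Gamma_nat_add_pos hl k).ne'
  have h2 : (2 : ℝ) ^ l ≠ 0 := by positivity
  have h3 : (k.factorial : ℝ) ≠ 0 := by positivity
  unfold besselCoeff
  rw [show ((k + 1 : ℕ) : ℝ) + l + 1 = (k + l + 1) + 1 by push_cast; ring,
    Real.Gamma_add_one h0.ne', Nat.factorial_succ]
  push_cast
  rw [pow_succ]
  field_simp

lemma besselCoeff_succ_mul {l : ℝ} (hl : -1 < l) (k : ℕ) :
    besselCoeff l (k + 1) * (2 * (k + 1)) = -besselCoeff (l + 1) k := by
  have h1 := (Gamma_nat_add_pos hl (k + 1)).ne'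
  have h2 : (2 : ℝ) ^ l ≠ 0 := by positivity
  have h3 : (k.factorial : ℝ) ≠ 0 := by positivity
  unfold besselCoeff
  rw [Real.rpow_add two_pos, Real.rpow_one, Nat.factorial_succ]
  push_cast at h1 ⊢
  rw [show (k : ℝ) + (l + 1) + 1 = k + 1 + l + 1 by ring]
  field_simp
  ring

lemma summable_besselCoeff {l : ℝ} (hl : -1 < l) {R : ℝ} (hR : 0 < R) :
    Summable fun k : ℕ => |besselCoeff l k| * R ^ k := by
  have hpos : ∀ k : ℕ, 0 < |besselCoeff l k| * R ^ k := fun k =>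
    mul_pos (abs_pos.2 (besselCoeff_ne_zero hl k)) (pow_pos hR k)
  refine summable_of_ratio_test_tendsto_lt_one (l := 0) one_pos
    (Eventually.of_forall fun k => (hpos k).ne') ?_
  have hlim : Tendsto (fun k : ℕ => R / 4 * (((k : ℝ) + (l + 1))⁻¹ * ((k : ℝ) + 1)⁻¹)) atTop
      (𝓝 (R / 4 * (0 * 0))) := by
    have h0 := tendsto_natCast_atTop_atTop (R := ℝ)
    exact (((tendsto_atTop_add_const_right _ (l + 1) h0).inv_tendsto_atTop).mul
      ((tendsto_atTop_add_const_right _ 1 h0).inv_tendsto_atTop)).const_mul _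
  rw [mul_zero, mul_zero] at hlim
  refine hlim.congr fun k => ?_
  have h0 : (0 : ℝ) < k + l + 1 := by
    have : (0 : ℝ) ≤ k := k.cast_nonneg
    linarith
  have h1 : |besselCoeff l k| ≠ 0 := (abs_pos.2 (besselCoeff_ne_zero hl k)).ne'
  rw [Real.norm_of_nonneg (hpos _).le, Real.norm_of_nonneg (hpos _).le, besselCoeff_succ hl,
    abs_mul, abs_div, abs_of_pos (show 0 < ((k : ℝ) + l + 1) * (k + 1) by positivity), pow_succ,
    ← add_assoc]
  norm_num
  field_simp

lemma summable_besselCoeff_mul_pow {l : ℝ} (hl : -1 < l) (x : ℝ) :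
    Summable fun k : ℕ => |besselCoeff l k| * |x| ^ (2 * k) := by
  refine Summable.of_nonneg_of_le (fun k => by positivity) (fun k => ?_)
    (summable_besselCoeff hl (show 0 < x ^ 2 + 1 by positivity))
  rw [pow_mul, sq_abs]
  gcongr
  linarith

lemma besselj_eq_tsum (l x : ℝ) : besselj l x = ∑' k : ℕ, besselCoeff l k * x ^ (2 * k) := by
  rw [besselj, ← tsum_mul_left]
  congr 1
  ext k
  rw [besselCoeff, show -(x ^ 2) / 4 = (-1 / 4) * x ^ 2 by ring, mul_pow, pow_mul]
  ring

lemma hasSum_besselj {l : ℝ} (hl : -1 < l) (x : ℝ) :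
    HasSum (fun k : ℕ => besselCoeff l k * x ^ (2 * k)) (besselj l x) := by
  rw [besselj_eq_tsum]
  apply Summable.hasSum
  apply Summable.of_norm
  simpa [abs_mul, abs_pow] using summable_besselCoeff_mul_pow hl x

/-- The recurrence `j_λ'(x) = -x j_{λ+1}(x)`, by termwise differentiation. -/
lemma hasDerivAt_besselj {l : ℝ} (hl : -1 < l) (x : ℝ) :
    HasDerivAt (besselj l) (-x * besselj (l + 1) x) x := by
  set R := |x| + 1 with hR
  have hshift : ∀ (k : ℕ) (y : ℝ), besselCoeff l (k + 1) *
      (((2 * (k + 1) : ℕ) : ℝ) * y ^ (2 * (k + 1) - 1)) =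
      -y * (besselCoeff (l + 1) k * y ^ (2 * k)) := by
    intro k y
    rw [show 2 * (k + 1) - 1 = 2 * k + 1 by lia]
    push_cast
    rw [← mul_assoc, besselCoeff_succ_mul hl, pow_succ]
    ring
  have key := hasDerivAt_tsum_of_isPreconnected (t := Metric.ball (0 : ℝ) R) (y₀ := 0) (y := x)
    (g := fun (k : ℕ) (y : ℝ) => besselCoeff l k * y ^ (2 * k))
    (g' := fun (k : ℕ) (y : ℝ) => besselCoeff l k * (((2 * k : ℕ) : ℝ) * y ^ (2 * k - 1)))
    (u := fun k : ℕ => |besselCoeff l k| * (((2 * k : ℕ) : ℝ) * R ^ (2 * k - 1)))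
    ?_ Metric.isOpen_ball (convex_ball 0 R).isPreconnected ?_ ?_ ?_
    (hasSum_besselj hl 0).summable ?_
  · rw [← funext (besselj_eq_tsum l)] at key
    convert! key using 1
    have hs : Summable fun k : ℕ => besselCoeff l k * (((2 * k : ℕ) : ℝ) * x ^ (2 * k - 1)) := by
      rw [← summable_nat_add_iff 1]
      simp_rw [hshift]
      exact (hasSum_besselj (by linarith) x).summable.mul_left _
    rw [hs.tsum_eq_zero_add]
    simp_rw [hshift, tsum_mul_left, ← besselj_eq_tsum]
    simp
  · rw [← summable_nat_add_iff 1]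
    have := (summable_besselCoeff_mul_pow (l := l + 1) (by linarith) R).mul_left |R|
    refine this.congr fun k => ?_
    have h1 := congrArg abs (hshift k R)
    simp only [abs_mul, abs_pow, abs_neg, Nat.abs_cast] at h1
    rw [abs_of_pos (show 0 < R by positivity)] at h1 ⊢
    exact h1.symm
  · intro k y _
    exact (hasDerivAt_pow (2 * k) y).const_mul _
  · intro k y hy
    rw [mem_ball_zero_iff] at hy
    rw [norm_mul, norm_mul, norm_pow, Real.norm_eq_abs, Real.norm_natCast]
    gcongr
  · exact Metric.mem_ball_self (by positivity)
  · rw [mem_ball_zero_iff, Real.norm_eq_abs]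
    linarith

lemma continuous_besselj {l : ℝ} (hl : -1 < l) : Continuous (besselj l) :=
  continuous_iff_continuousAt.2 fun x => (hasDerivAt_besselj hl x).continuousAt

/-- Legendre's duplication formula in the form needed to compare with the cosine series. -/
lemma Gamma_nat_add_half_mul_factorial (k : ℕ) :
    Real.Gamma (k + 1 / 2) * k.factorial = (2 * k).factorial * √Real.pi / 4 ^ k := by
  have := Real.Gamma_mul_Gamma_add_half_of_pos (s := (k : ℝ) + 1 / 2) (by positivity)
  rw [show (k : ℝ) + 1 / 2 + 1 / 2 = k + 1 by ring, Real.Gamma_nat_eq_factorial,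
    show 2 * ((k : ℝ) + 1 / 2) = ((2 * k : ℕ) : ℝ) + 1 by push_cast; ring,
    Real.Gamma_nat_eq_factorial,
    show 1 - (((2 * k : ℕ) : ℝ) + 1) = -((2 * k : ℕ) : ℝ) by ring,
    Real.rpow_neg zero_le_two, Real.rpow_natCast, pow_mul] at this
  rw [this]
  norm_num
  field_simp

/-- Up to normalization, the Bessel function of order `-1/2` is the cosine, so that the
one-dimensional Hankel transform is the cosine transform. -/
lemma besselj_neg_half (x : ℝ) : besselj (-1 / 2) x = √2 / √Real.pi * Real.cos x := by
  refine (hasSum_besselj (by norm_num) x).unique ?_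
  convert! (Real.hasSum_cos x).mul_left (√2 / √Real.pi) using 2 with k
  have h1 := Gamma_nat_add_half_mul_factorial k
  have h2 : √Real.pi ≠ 0 := by positivity
  have h3 : Real.Gamma ((k : ℝ) + 1 / 2) ≠ 0 := (Real.Gamma_pos_of_pos (by positivity)).ne'
  have h4 : ((2 * k).factorial : ℝ) ≠ 0 := by positivity
  have h5 : (k.factorial : ℝ) ≠ 0 := by positivity
  rw [besselCoeff, show (k : ℝ) + -1 / 2 + 1 = k + 1 / 2 by ring,
    show (-1 / 2 : ℝ) = -(1 / 2) by ring, Real.rpow_neg zero_le_two, ← Real.sqrt_eq_rpow]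
  have h6 : 1 / Real.Gamma ((k : ℝ) + 1 / 2) * ((-1 / 4) ^ k / (k.factorial : ℝ)) =
      (-1 / 4) ^ k / (Real.Gamma ((k : ℝ) + 1 / 2) * k.factorial) := by field_simp
  rw [h6, h1, div_pow]
  field_simp

/-! ### The Hankel transform of `h` and the integral `I` -/

/-- Termwise integration of the Bessel series against an integrable weight on `(0,1)`. -/
lemma hasSum_integral_mul_besselj {l : ℝ} (hl : -1 < l) {w : ℝ → ℝ}
    (hw : IntegrableOn w (Ioo 0 1)) (t : ℝ) :
    HasSum (fun k : ℕ => besselCoeff l k * t ^ (2 * k) * ∫ u in Ioo (0 : ℝ) 1, w u * u ^ (2 * k))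
      (∫ u in Ioo (0 : ℝ) 1, w u * besselj l (t * u)) := by
  have hle : ∀ k : ℕ, ∀ u ∈ Ioo (0 : ℝ) 1, ‖u ^ (2 * k)‖ ≤ 1 := by
    intro k u hu
    rw [norm_pow, Real.norm_of_nonneg hu.1.le]
    exact pow_le_one₀ hu.1.le hu.2.le
  have hwk : ∀ k : ℕ, IntegrableOn (fun u => w u * u ^ (2 * k)) (Ioo 0 1) := by
    intro k
    exact hw.mul_bdd (c := 1) (by fun_prop)
      ((ae_restrict_mem measurableSet_Ioo).mono fun u hu => hle k u hu)
  have key := hasSum_integral_of_summable_integral_norm (μ := volume.restrict (Ioo (0 : ℝ) 1))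
    (F := fun (k : ℕ) u => besselCoeff l k * t ^ (2 * k) * (w u * u ^ (2 * k)))
    (fun k => (hwk k).const_mul _) ?_
  · simp_rw [integral_const_mul] at key
    convert! key using 1
    refine setIntegral_congr_fun measurableSet_Ioo fun u _ => ?_
    rw [besselj_eq_tsum, ← tsum_mul_left]
    congr 1
    ext k
    rw [mul_pow]
    ring
  · refine Summable.of_nonneg_of_le (fun k => integral_nonneg fun u => norm_nonneg _) (fun k => ?_)
      ((summable_besselCoeff_mul_pow hl t).mul_right (∫ u in Ioo (0 : ℝ) 1, ‖w u‖))
    rw [← integral_const_mul]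
    refine setIntegral_mono_on ((hwk k).const_mul _).norm (hw.norm.const_mul _)
      measurableSet_Ioo fun u hu => ?_
    rw [norm_mul, norm_mul, norm_mul, norm_pow, Real.norm_eq_abs, Real.norm_eq_abs t]
    gcongr
    exact mul_le_of_le_one_right (norm_nonneg _) (hle k u hu)

lemma I_one_eq (μ ν α t : ℝ) : I 1 μ ν α t =
    ∫ x in Ioo (0 : ℝ) 1, x ^ α * (1 - x) ^ (μ - 1) * besselj (ν - 1 / 2) (t * x) := by
  rw [I, intervalIntegral.integral_of_le zero_le_one, integral_Ioc_eq_integral_Ioo]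
  refine setIntegral_congr_fun measurableSet_Ioo fun x _ => ?_
  simp only [Real.rpow_one]
  ring

lemma integrableOn_rpow_mul_one_sub_rpow {α μ : ℝ} (hα : -1 < α) (hμ : 0 < μ) :
    IntegrableOn (fun x : ℝ => x ^ α * (1 - x) ^ (μ - 1)) (Ioo 0 1) := by
  simpa using integrableOn_beta (a := α + 1) (by linarith) hμ

lemma hasSum_I {μ ν α : ℝ} (hμ : 0 < μ) (hν : -1 / 2 < ν) (hα : -1 < α) (t : ℝ) :
    HasSum (fun k : ℕ => besselCoeff (ν - 1 / 2) k * t ^ (2 * k) *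
      (Real.Gamma (α + 2 * k + 1) * Real.Gamma μ / Real.Gamma (α + 2 * k + 1 + μ)))
      (I 1 μ ν α t) := by
  rw [I_one_eq]
  convert! hasSum_integral_mul_besselj (l := ν - 1 / 2) (by linarith)
    (integrableOn_rpow_mul_one_sub_rpow hα hμ) t using 2 with k
  congr 1
  rw [← integral_beta (a := α + 2 * k + 1) (by have : (0 : ℝ) ≤ k := k.cast_nonneg; linarith) hμ]
  refine setIntegral_congr_fun measurableSet_Ioo fun x hx => ?_
  rw [show α + 2 * k + 1 - 1 = α + (2 * k : ℕ) by push_cast; ring, Real.rpow_add hx.1,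
    Real.rpow_natCast]
  ring

/-- The power series of the Hankel transform of `h`, with coefficients given by the moments. -/
lemma hasSum_hankel_h {m μ ν : ℝ} (hm : 1 ≤ m) (hμ : 0 < μ) (hν : 1 / 2 < ν) (hμν : 1 < μ + ν)
    (t : ℝ) :
    HasSum (fun k : ℕ => besselCoeff (m / 2 - 1) k * t ^ (2 * k) *
      (Real.Gamma (2 * ν + (m - 1 + 2 * k)) * Real.Gamma μ /
        Real.Gamma (2 * ν + (m - 1 + 2 * k) + μ) *
      (Real.Gamma ν * Real.Gamma ((m - 1 + 2 * k + 1) / 2) /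
        Real.Gamma (ν + (m - 1 + 2 * k + 1) / 2) / 2)))
      (hankel m (h μ ν) t) := by
  have hw : IntegrableOn (fun u => h μ ν u * u ^ (m - 1)) (Ioo 0 1) := by
    refine ContinuousOn.integrableOn_Icc (ContinuousOn.mul
      (continuous_h hμ hν hμν).continuousOn ?_) |>.mono_set Ioo_subset_Icc_self
    exact (Real.continuous_rpow_const (by linarith)).continuousOn
  have heq : hankel m (h μ ν) t =
      ∫ u in Ioo (0 : ℝ) 1, h μ ν u * u ^ (m - 1) * besselj (m / 2 - 1) (t * u) := by
    simp_rw [hankel, mul_assoc]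
    exact integral_Ioi_mul_h μ ν _
  rw [heq]
  convert! hasSum_integral_mul_besselj (l := m / 2 - 1) (by linarith) hw t using 2 with k
  congr 1
  have hk : (0 : ℝ) ≤ k := k.cast_nonneg
  rw [← integral_h_mul_rpow hμ hν (by linarith)]
  refine setIntegral_congr_fun measurableSet_Ioo fun x hx => ?_
  rw [show m - 1 + 2 * (k : ℝ) = m - 1 + (2 * k : ℕ) by push_cast; ring, Real.rpow_add hx.1,
    Real.rpow_natCast]
  ring

/-- The Hankel transform of `h` is, up to a constant, the integral `I`: the two power series
agree term by term. -/
lemma hankel_h_eq {m μ ν : ℝ} (hm : 1 ≤ m) (hμ : 0 < μ) (hν : 1 / 2 < ν) (hμν : 1 < μ + ν)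
    (t : ℝ) :
    hankel m (h μ ν) t = 2 ^ (ν - 1) * Real.Gamma ν *
      I 1 μ ((m - 1) / 2 + ν) (m - 1 + 2 * ν - 1) t := by
  refine (hasSum_hankel_h hm hμ hν hμν t).unique ?_
  convert! (hasSum_I (μ := μ) (ν := (m - 1) / 2 + ν) (α := m - 1 + 2 * ν - 1) hμ (by linarith)
    (by linarith) t).mul_left (2 ^ (ν - 1) * Real.Gamma ν) using 2 with k
  have hk : (0 : ℝ) ≤ k := k.cast_nonneg
  have h1 : Real.Gamma (k + m / 2) ≠ 0 := (Real.Gamma_pos_of_pos (by linarith)).ne'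
  have h2 : Real.Gamma (k + m / 2 + ν) ≠ 0 := (Real.Gamma_pos_of_pos (by linarith)).ne'
  have h3 : Real.Gamma (2 * ν + (m - 1 + 2 * k) + μ) ≠ 0 :=
    (Real.Gamma_pos_of_pos (by linarith)).ne'
  have h4 : (2 : ℝ) ^ (m / 2) ≠ 0 := by positivity
  have h5 : (2 : ℝ) ^ ν ≠ 0 := by positivity
  have h6 : (k.factorial : ℝ) ≠ 0 := by positivity
  simp only [besselCoeff]
  rw [show m - 1 + 2 * ν - 1 + 2 * k + 1 = 2 * ν + (m - 1 + 2 * k) by ring,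
    show (m - 1 + 2 * (k : ℝ) + 1) / 2 = k + m / 2 by ring,
    show ν + (k + m / 2) = k + m / 2 + ν by ring,
    show (k : ℝ) + (m / 2 - 1) + 1 = k + m / 2 by ring,
    show (k : ℝ) + ((m - 1) / 2 + ν - 1 / 2) + 1 = k + m / 2 + ν by ring,
    show (m - 1) / 2 + ν - 1 / 2 = m / 2 + ν - 1 by ring,
    Real.rpow_sub two_pos, Real.rpow_sub two_pos, Real.rpow_sub two_pos, Real.rpow_add two_pos,
    Real.rpow_one]
  field_simp

/-- Differentiation of `I` under the integral sign. -/
lemma hasDerivAt_I {μ ν α : ℝ} (hμ : 0 < μ) (hν : -1 / 2 < ν) (hα : -1 < α) (t : ℝ) :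
    HasDerivAt (I 1 μ ν α) (-t * I 1 μ (ν + 1) (α + 2) t) t := by
  have hl : -1 < ν - 1 / 2 := by linarith
  have hw := integrableOn_rpow_mul_one_sub_rpow hα hμ
  have hcont := continuous_besselj (l := ν - 1 / 2 + 1) (by linarith)
  obtain ⟨C, hC⟩ := (isCompact_Icc (a := -(|t| + 1)) (b := |t| + 1)).exists_bound_of_continuousOn
    hcont.continuousOn
  have hmem : ∀ s ∈ Metric.ball t 1, ∀ x ∈ Ioo (0 : ℝ) 1, |s| ≤ |t| + 1 ∧ |s * x| ≤ |t| + 1 := by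
    intro s hs x hx
    have h1 : |s| ≤ |t| + 1 := by
      rw [Metric.mem_ball, Real.dist_eq] at hs
      have := abs_sub_abs_le_abs_sub s t
      linarith
    refine ⟨h1, ?_⟩
    rw [abs_mul, abs_of_pos hx.1]
    exact (mul_le_of_le_one_right (abs_nonneg _) hx.2.le).trans h1
  have key := (hasDerivAt_integral_of_dominated_loc_of_deriv_le
    (μ := volume.restrict (Ioo (0 : ℝ) 1)) (x₀ := t) (s := Metric.ball t 1)
    (F := fun s x => x ^ α * (1 - x) ^ (μ - 1) * besselj (ν - 1 / 2) (s * x))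
    (F' := fun s x => x ^ α * (1 - x) ^ (μ - 1) *
      (-(s * x) * besselj (ν - 1 / 2 + 1) (s * x) * x))
    (bound := fun x => x ^ α * (1 - x) ^ (μ - 1) * ((|t| + 1) * C))
    (Metric.ball_mem_nhds _ one_pos) ?_ ?_ ?_ ?_ ?_ ?_).2
  · rw [funext (I_one_eq μ ν α)]
    convert! key using 1
    rw [I_one_eq, ← integral_const_mul]
    refine setIntegral_congr_fun measurableSet_Ioo fun x hx => ?_
    rw [Real.rpow_add hx.1, Real.rpow_two, show ν + 1 - 1 / 2 = ν - 1 / 2 + 1 by ring]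
    ring
  · refine Eventually.of_forall fun s => ?_
    exact (hw.aestronglyMeasurable).mul
      ((continuous_besselj hl).comp (by fun_prop)).aestronglyMeasurable
  · obtain ⟨C', hC'⟩ :=
      (isCompact_Icc (a := -(|t| + 1)) (b := |t| + 1)).exists_bound_of_continuousOn
      (continuous_besselj hl).continuousOn
    refine hw.mul_bdd (c := C') ((continuous_besselj hl).comp (by fun_prop)).aestronglyMeasurable
      ((ae_restrict_mem measurableSet_Ioo).mono fun x hx => hC' _ ?_)
    exact abs_le.1 (hmem t (Metric.mem_ball_self one_pos) x hx).2
  · refine (hw.aestronglyMeasurable).mul (Continuous.aestronglyMeasurable ?_)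
    have := hcont.comp (show Continuous fun x : ℝ => t * x by fun_prop)
    simp only [Function.comp_def] at this
    fun_prop
  · refine (ae_restrict_mem measurableSet_Ioo).mono fun x hx s hs => ?_
    have h1 : 0 ≤ x ^ α * (1 - x) ^ (μ - 1) :=
      mul_nonneg (Real.rpow_nonneg hx.1.le _) (Real.rpow_nonneg (by linarith [hx.2]) _)
    have h2 := (hmem s hs x hx).2
    have h3 := hC (s * x) (abs_le.1 h2)
    rw [norm_mul, Real.norm_of_nonneg h1, norm_mul, norm_mul, norm_neg, Real.norm_of_nonneg hx.1.le]
    refine mul_le_mul_of_nonneg_left ?_ h1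
    have h4 : 0 ≤ C := (norm_nonneg _).trans h3
    calc _ ≤ ‖s * x‖ * ‖besselj (ν - 1 / 2 + 1) (s * x)‖ :=
          mul_le_of_le_one_right (by positivity) hx.2.le
      _ ≤ (|t| + 1) * C := by
          gcongr
          exact h2
  · exact hw.mul_const _
  · refine (ae_restrict_mem measurableSet_Ioo).mono fun x hx s hs => ?_
    have h1 : HasDerivAt (fun s : ℝ => s * x) x s := by
      simpa using (hasDerivAt_id s).mul_const x
    exact ((hasDerivAt_besselj hl (s * x)).comp s h1).const_mul _

/-! ### The Fourier transform on the line -/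

lemma hHat_eq_integral_cos {μ ν : ℝ} (hμ : 0 < μ) (hν : 1 / 2 < ν) (hμν : 1 < μ + ν) (t : ℝ) :
    hHat μ ν t = ∫ x : ℝ, h μ ν x * Real.cos (t * x) := by
  have hint : Integrable fun x : ℝ => Complex.exp (-(Complex.I * t * x)) * (h μ ν x : ℂ) := by
    refine (integrable_h hμ hν hμν).ofReal.bdd_mul (c := 1) (by fun_prop)
      (Eventually.of_forall fun x => ?_)
    rw [show -(Complex.I * t * x) = ((-(t * x) : ℝ) : ℂ) * Complex.I by push_cast; ring,
      Complex.norm_exp_ofReal_mul_I]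
  rw [hHat]
  have h1 : (∫ x : ℝ, Complex.exp (-(Complex.I * t * x)) * (h μ ν x : ℂ)).re =
      ∫ x : ℝ, (Complex.exp (-(Complex.I * t * x)) * (h μ ν x : ℂ)).re :=
    (integral_re hint).symm
  rw [h1]
  congr 1
  ext x
  rw [show -(Complex.I * t * x) = ((-(t * x) : ℝ) : ℂ) * Complex.I by push_cast; ring,
    Complex.re_mul_ofReal, Complex.exp_ofReal_mul_I_re, Real.cos_neg, mul_comm]

lemma hHat_eq_hankel {μ ν : ℝ} (hμ : 0 < μ) (hν : 1 / 2 < ν) (hμν : 1 < μ + ν) (t : ℝ) :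
    hHat μ ν t = √2 * √Real.pi * hankel 1 (h μ ν) t := by
  have h1 : (∫ x : ℝ, h μ ν x * Real.cos (t * x)) =
      2 * ∫ x in Ioi (0 : ℝ), h μ ν x * Real.cos (t * x) := by
    rw [← integral_comp_abs]
    congr 1
    ext x
    rw [h_abs]
    congr 1
    rcases abs_choice x with hx | hx <;> rw [hx]
    rw [mul_neg, Real.cos_neg]
  have h2 : hankel 1 (h μ ν) t =
      √2 / √Real.pi * ∫ x in Ioi (0 : ℝ), h μ ν x * Real.cos (t * x) := by
    rw [hankel, ← integral_const_mul]
    congr 1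
    ext x
    rw [sub_self, Real.rpow_zero, show (1 / 2 - 1 : ℝ) = -1 / 2 by norm_num, besselj_neg_half]
    ring
  rw [hHat_eq_integral_cos hμ hν hμν, h1, h2]
  have h3 : √Real.pi ≠ 0 := by positivity
  have h4 : √2 * √2 = 2 := Real.mul_self_sqrt zero_le_two
  field_simp
  rw [sq, h4, mul_comm]

lemma abs_hHat_le {μ ν : ℝ} (hμ : 0 < μ) (hν : 1 / 2 < ν) (hμν : 1 < μ + ν) (t : ℝ) :
    |hHat μ ν t| ≤ ∫ x : ℝ, ‖h μ ν x‖ := by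
  rw [hHat_eq_integral_cos hμ hν hμν, ← Real.norm_eq_abs]
  refine norm_integral_le_of_norm_le (integrable_h hμ hν hμν).norm
    (Eventually.of_forall fun x => ?_)
  rw [norm_mul]
  exact mul_le_of_le_one_right (norm_nonneg _) (Real.abs_cos_le_one _)

lemma continuous_hHat {μ ν : ℝ} (hμ : 0 < μ) (hν : 1 / 2 < ν) (hμν : 1 < μ + ν) :
    Continuous (hHat μ ν) := by
  rw [funext (hHat_eq_integral_cos hμ hν hμν)]
  have hc := continuous_h hμ hν hμν
  refine continuous_of_dominated (bound := fun x => ‖h μ ν x‖)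
    (fun t => Continuous.aestronglyMeasurable (by fun_prop))
    (fun t => Eventually.of_forall fun x => ?_) (integrable_h hμ hν hμν).norm
    (Eventually.of_forall fun x => by fun_prop)
  rw [norm_mul]
  exact mul_le_of_le_one_right (norm_nonneg _) (Real.abs_cos_le_one _)

/-- The power series of the Fourier transform. The Gamma factor in the denominator is the one
that a Laplace transform against `t ^ (2 * ν + μ - 1)` cancels. -/
lemma hasSum_hHat {μ ν : ℝ} (hμ : 0 < μ) (hν : 1 / 2 < ν) (hμν : 1 < μ + ν) (t : ℝ) :
    HasSum (fun k : ℕ => Real.Gamma μ * Real.Gamma ν * 2 ^ (2 * ν - 1) *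
      (Real.Gamma (ν + k) / k.factorial * (-1) ^ k / Real.Gamma (2 * ν + μ + 2 * k)) *
        t ^ (2 * k)) (hHat μ ν t) := by
  rw [hHat_eq_hankel hμ hν hμν]
  convert! (hasSum_hankel_h le_rfl hμ hν hμν t).mul_left (√2 * √Real.pi) using 2 with k
  have hk : (0 : ℝ) ≤ k := k.cast_nonneg
  have hdup := Real.Gamma_mul_Gamma_add_half_of_pos (s := ν + k) (by linarith)
  have h0 : √Real.pi ≠ 0 := by positivity
  have h1 : √2 * √2 = 2 := Real.mul_self_sqrt zero_le_two
  have h2 : Real.Gamma ((k : ℝ) + 1 / 2) ≠ 0 := (Real.Gamma_pos_of_pos (by positivity)).ne'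
  have h3 : Real.Gamma (ν + k + 1 / 2) ≠ 0 := (Real.Gamma_pos_of_pos (by linarith)).ne'
  have h4 : Real.Gamma (2 * ν + μ + 2 * k) ≠ 0 := (Real.Gamma_pos_of_pos (by linarith)).ne'
  have h5 : (k.factorial : ℝ) ≠ 0 := by positivity
  have h6 : (2 : ℝ) ^ (2 * ν) ≠ 0 := by positivity
  have e : (2 : ℝ) ^ (1 - 2 * (ν + k)) = 2 / (2 ^ (2 * ν) * 4 ^ k) := by
    rw [Real.rpow_sub two_pos, mul_add, Real.rpow_add two_pos, Real.rpow_one,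
      show 2 * (k : ℝ) = ((2 * k : ℕ) : ℝ) by push_cast; ring, Real.rpow_natCast, pow_mul]
    norm_num
  rw [e, show 2 * (ν + k) = 2 * ν + 2 * k by ring] at hdup
  rw [besselCoeff, show 2 * ν + (1 - 1 + 2 * (k : ℝ)) = 2 * ν + 2 * k by ring,
    show 2 * ν + 2 * (k : ℝ) + μ = 2 * ν + μ + 2 * k by ring,
    show (1 - 1 + 2 * (k : ℝ) + 1) / 2 = k + 1 / 2 by ring,
    show ν + ((k : ℝ) + 1 / 2) = ν + k + 1 / 2 by ring,
    show (k : ℝ) + (1 / 2 - 1) + 1 = k + 1 / 2 by ring,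
    show (1 / 2 - 1 : ℝ) = -(1 / 2) by ring, Real.rpow_neg zero_le_two, ← Real.sqrt_eq_rpow,
    Real.rpow_sub two_pos, Real.rpow_one, div_pow (-1 : ℝ)]
  have h7 : Real.Gamma (2 * ν + 2 * k) =
      Real.Gamma (ν + k) * Real.Gamma (ν + k + 1 / 2) * (2 ^ (2 * ν) * 4 ^ k) / 2 / √Real.pi := by
    rw [hdup]; field_simp
  rw [h7]
  have h8 : (√2) ^ 2 = 2 := by rw [sq, h1]
  field_simp
  rw [h8]
  ring

/-! ### The Laplace transform -/

/-- Half of the exponential absorbs the power of `t`. -/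
lemma integrableOn_pow_mul_exp_mul {φ : ℝ → ℝ}
    (hφ : ∀ x : ℝ, 0 < x → IntegrableOn (fun t : ℝ => Real.exp (-(t * x)) * φ t) (Ioi 0))
    (k : ℕ) {x : ℝ} (hx : 0 < x) :
    IntegrableOn (fun t : ℝ => t ^ k * (Real.exp (-(t * x)) * φ t)) (Ioi 0) := by
  have h1 := hφ (x / 2) (by positivity)
  have h2 : IntegrableOn (fun t : ℝ => t ^ k * Real.exp (-(t * (x / 2))) *
      (Real.exp (-(t * (x / 2))) * φ t)) (Ioi 0) := by
    refine Integrable.bdd_mul (c := k.factorial / (x / 2) ^ k) h1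
      (Continuous.aestronglyMeasurable (by fun_prop))
      ((ae_restrict_mem measurableSet_Ioi).mono fun t (ht : 0 < t) => ?_)
    have h3 := Real.pow_div_factorial_le_exp (t * (x / 2)) (by positivity) k
    rw [Real.norm_of_nonneg (by positivity), Real.exp_neg, ← div_eq_mul_inv,
      div_le_div_iff₀ (by positivity) (by positivity), ← mul_pow]
    rwa [div_le_iff₀' (by positivity)] at h3
  refine h2.congr (Eventually.of_forall fun t => ?_)
  have : Real.exp (-(t * x)) = Real.exp (-(t * (x / 2))) * Real.exp (-(t * (x / 2))) := by
    rw [← Real.exp_add]; ring_nf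
  simp only [this]
  ring

lemma norm_cexp_neg_mul (t : ℝ) (z : ℂ) : ‖Complex.exp (-(t * z))‖ = Real.exp (-(t * z.re)) := by
  rw [Complex.norm_exp, Complex.neg_re, Complex.re_ofReal_mul]

/-- Differentiation of the complex Laplace transform on the right half-plane. -/
lemma hasDerivAt_complex_laplace {φ : ℝ → ℝ}
    (hφ : ∀ x : ℝ, 0 < x → IntegrableOn (fun t : ℝ => Real.exp (-(t * x)) * φ t) (Ioi 0))
    (k : ℕ) {z : ℂ} (hz : 0 < z.re) :
    HasDerivAt (fun z : ℂ => ∫ t in Ioi (0 : ℝ), (-t : ℂ) ^ k * (Complex.exp (-(t * z)) * φ t))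
      (∫ t in Ioi (0 : ℝ), (-t : ℂ) ^ (k + 1) * (Complex.exp (-(t * z)) * φ t)) z := by
  have hφm : AEStronglyMeasurable (fun t => (φ t : ℂ)) (volume.restrict (Ioi (0 : ℝ))) := by
    have h1 := (hφ 1 one_pos).aestronglyMeasurable
    have h2 : AEStronglyMeasurable (fun t : ℝ => Real.exp t) (volume.restrict (Ioi (0 : ℝ))) :=
      Real.continuous_exp.aestronglyMeasurable
    refine Complex.continuous_ofReal.comp_aestronglyMeasurable ((h2.mul h1).congr
      (Eventually.of_forall fun t => ?_))
    simp only [Pi.mul_apply, mul_one]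
    rw [← mul_assoc, ← Real.exp_add, add_neg_cancel, Real.exp_zero, one_mul]
  have hmeas : ∀ (j : ℕ) (w : ℂ), AEStronglyMeasurable
      (fun t : ℝ => (-t : ℂ) ^ j * (Complex.exp (-(t * w)) * φ t))
      (volume.restrict (Ioi (0 : ℝ))) := fun j w =>
    (Continuous.aestronglyMeasurable (by fun_prop)).mul
      ((Continuous.aestronglyMeasurable (by fun_prop)).mul hφm)
  have hnorm : ∀ (j : ℕ) (w : ℂ) (t : ℝ), 0 < t →
      ‖(-t : ℂ) ^ j * (Complex.exp (-(t * w)) * φ t)‖ =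
        ‖t ^ j * (Real.exp (-(t * w.re)) * φ t)‖ := by
    intro j w t ht
    rw [norm_mul, norm_mul, norm_cexp_neg_mul, norm_pow, norm_neg, Complex.norm_real,
      Complex.norm_real, norm_mul, norm_mul, norm_pow, Real.norm_of_nonneg (Real.exp_pos _).le]
  refine (hasDerivAt_integral_of_dominated_loc_of_deriv_le (s := Metric.ball z (z.re / 2))
    (F := fun (z : ℂ) (t : ℝ) => (-t : ℂ) ^ k * (Complex.exp (-(t * z)) * φ t))
    (F' := fun (z : ℂ) (t : ℝ) => (-t : ℂ) ^ (k + 1) * (Complex.exp (-(t * z)) * φ t))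
    (bound := fun t => ‖t ^ (k + 1) * (Real.exp (-(t * (z.re / 2))) * φ t)‖)
    (Metric.ball_mem_nhds _ (by positivity)) (Eventually.of_forall fun w => hmeas k w) ?_
    (hmeas (k + 1) z) ?_ ?_ ?_).2
  · refine (integrableOn_pow_mul_exp_mul hφ k hz).norm.mono' (hmeas k z) ?_
    exact (ae_restrict_mem measurableSet_Ioi).mono fun t ht => (hnorm k z t ht).le
  · refine (ae_restrict_mem measurableSet_Ioi).mono fun t (ht : 0 < t) w hw => ?_
    have h1 : z.re / 2 ≤ w.re := by
      rw [Metric.mem_ball, dist_eq_norm] at hw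
      have := (abs_le.1 ((Complex.abs_re_le_norm (w - z)).trans hw.le)).1
      rw [Complex.sub_re] at this
      linarith
    rw [hnorm _ _ _ ht, norm_mul, norm_mul, norm_mul, norm_mul,
      Real.norm_of_nonneg (Real.exp_pos _).le, Real.norm_of_nonneg (Real.exp_pos _).le]
    gcongr
  · exact (integrableOn_pow_mul_exp_mul hφ (k + 1) (by positivity)).norm
  · refine Eventually.of_forall fun t w _ => ?_
    have h1 : HasDerivAt (fun w : ℂ => -((t : ℂ) * w)) (-(t : ℂ)) w := by
      simpa using ((hasDerivAt_id w).const_mul (t : ℂ)).fun_neg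
    convert! ((h1.cexp).mul_const (φ t : ℂ)).const_mul ((-t : ℂ) ^ k) using 1
    ring

lemma hasDerivAt_laplace {φ : ℝ → ℝ}
    (hφ : ∀ x : ℝ, 0 < x → IntegrableOn (fun t : ℝ => Real.exp (-(t * x)) * φ t) (Ioi 0))
    (k : ℕ) {x : ℝ} (hx : 0 < x) :
    HasDerivAt (fun x : ℝ => ∫ t in Ioi (0 : ℝ), (-t) ^ k * (Real.exp (-(t * x)) * φ t))
      (∫ t in Ioi (0 : ℝ), (-t) ^ (k + 1) * (Real.exp (-(t * x)) * φ t)) x := by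
  have hre : ∀ (j : ℕ) (y : ℝ), (∫ t in Ioi (0 : ℝ), (-t : ℂ) ^ j *
      (Complex.exp (-(t * (y : ℂ))) * φ t)).re =
      ∫ t in Ioi (0 : ℝ), (-t) ^ j * (Real.exp (-(t * y)) * φ t) := by
    intro j y
    rw [← Complex.ofReal_re (∫ t in Ioi (0 : ℝ), (-t) ^ j * (Real.exp (-(t * y)) * φ t)),
      ← integral_complex_ofReal]
    push_cast
    rfl
  have := (hasDerivAt_complex_laplace hφ k (z := (x : ℂ)) (by simpa)).real_of_complex
  simpa only [hre] using this

lemma iteratedDeriv_laplace {φ : ℝ → ℝ}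
    (hφ : ∀ x : ℝ, 0 < x → IntegrableOn (fun t : ℝ => Real.exp (-(t * x)) * φ t) (Ioi 0))
    (k : ℕ) {x : ℝ} (hx : 0 < x) :
    iteratedDeriv k (laplace φ) x =
      ∫ t in Ioi (0 : ℝ), (-t) ^ k * (Real.exp (-(t * x)) * φ t) := by
  induction k generalizing x with
  | zero => simp [laplace]
  | succ k ih =>
    rw [iteratedDeriv_succ]
    have : iteratedDeriv k (laplace φ) =ᶠ[𝓝 x]
        fun x => ∫ t in Ioi (0 : ℝ), (-t) ^ k * (Real.exp (-(t * x)) * φ t) := by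
      filter_upwards [Ioi_mem_nhds hx] with y hy using ih hy
    rw [this.deriv_eq]
    exact (hasDerivAt_laplace hφ k hx).deriv

lemma contDiffOn_laplace {φ : ℝ → ℝ}
    (hφ : ∀ x : ℝ, 0 < x → IntegrableOn (fun t : ℝ => Real.exp (-(t * x)) * φ t) (Ioi 0)) :
    ContDiffOn ℝ ∞ (laplace φ) (Ioi 0) := by
  apply contDiffOn_of_differentiableOn_deriv
  intro k _
  have heq : EqOn (iteratedDerivWithin k (laplace φ) (Ioi 0))
      (fun x => ∫ t in Ioi (0 : ℝ), (-t) ^ k * (Real.exp (-(t * x)) * φ t)) (Ioi 0) := by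
    intro x hx
    rw [iteratedDerivWithin_of_isOpen isOpen_Ioi hx, iteratedDeriv_laplace hφ k hx]
  refine DifferentiableOn.congr (fun x hx => ?_) heq
  exact (hasDerivAt_laplace hφ k hx).differentiableAt.differentiableWithinAt

/-- An absolutely convergent Laplace transform is smooth, so that its complete monotonicity is a
matter of the signs of the integrals representing its derivatives. -/
lemma completelyMonotone_laplace_iff {φ : ℝ → ℝ}
    (hφ : ∀ x : ℝ, 0 < x → IntegrableOn (fun t : ℝ => Real.exp (-(t * x)) * φ t) (Ioi 0)) :
    CompletelyMonotone (laplace φ) ↔ ∀ (k : ℕ) (x : ℝ), 0 < x →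
      0 ≤ ∫ t in Ioi (0 : ℝ), t ^ k * (Real.exp (-(t * x)) * φ t) := by
  have key : ∀ (k : ℕ) (x : ℝ), 0 < x → (-1 : ℝ) ^ k * iteratedDeriv k (laplace φ) x =
      ∫ t in Ioi (0 : ℝ), t ^ k * (Real.exp (-(t * x)) * φ t) := by
    intro k x hx
    rw [iteratedDeriv_laplace hφ k hx, ← integral_const_mul]
    congr 1
    ext t
    rw [← mul_assoc, ← mul_pow]
    simp
  constructor
  · intro H k x hx
    rw [← key k x hx]
    exact H.2 k x hx
  · intro H
    refine ⟨contDiffOn_laplace hφ, fun k x hx => ?_⟩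
    rw [key k x hx]
    exact H k x hx

lemma integral_pow_mul_exp {r : ℝ} (hr : 0 < r) (N : ℕ) :
    ∫ t in Ioi (0 : ℝ), t ^ N * Real.exp (-(t * r)) = (1 / r) ^ (N + 1) * N.factorial := by
  have := Real.integral_rpow_mul_exp_neg_mul_Ioi (a := (N : ℝ) + 1) (by positivity) hr
  rw [Real.Gamma_nat_eq_factorial, add_sub_cancel_right] at this
  simp_rw [Real.rpow_natCast] at this
  rw [show ((N : ℝ) + 1) = ((N + 1 : ℕ) : ℝ) by push_cast; ring, Real.rpow_natCast] at this
  simpa only [mul_comm r] using this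

lemma integrableOn_rpow_mul_exp {a r : ℝ} (ha : -1 < a) (hr : 0 < r) :
    IntegrableOn (fun t : ℝ => t ^ a * Real.exp (-(t * r))) (Ioi 0) := by
  have := integrableOn_rpow_mul_exp_neg_mul_rpow (p := 1) (s := a) (b := r) ha one_pos hr
  simpa [mul_comm r] using this

lemma integrableOn_pow_mul_exp {r : ℝ} (hr : 0 < r) (N : ℕ) :
    IntegrableOn (fun t : ℝ => t ^ N * Real.exp (-(t * r))) (Ioi 0) := by
  have := integrableOn_rpow_mul_exp (a := (N : ℝ)) (r := r)
    (by have : (0 : ℝ) ≤ N := N.cast_nonneg; linarith) hr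
  simpa only [Real.rpow_natCast] using this

/-- The moments of the Gamma law with density proportional to `t ^ k * exp (-(t * (k / a)))`
converge to those of the point mass at `a`. -/
lemma tendsto_gamma_moment {a : ℝ} (ha : 0 < a) (j : ℕ) :
    Tendsto (fun k : ℕ => (∫ t in Ioi (0 : ℝ), t ^ (k + j) * Real.exp (-(t * (k / a)))) /
      ∫ t in Ioi (0 : ℝ), t ^ k * Real.exp (-(t * (k / a)))) atTop (𝓝 (a ^ j)) := by
  induction j with
  | zero =>
    rw [pow_zero]
    refine tendsto_const_nhds.congr' ?_
    filter_upwards [eventually_ge_atTop 1] with k hk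
    have hk' : (0 : ℝ) < k / a := div_pos (by exact_mod_cast hk) ha
    rw [add_zero, integral_pow_mul_exp hk', div_self (by positivity)]
  | succ j ih =>
    have h1 : Tendsto (fun k : ℕ => a * (1 + ((j : ℝ) + 1) * ((k : ℝ))⁻¹)) atTop
        (𝓝 (a * (1 + ((j : ℝ) + 1) * 0))) :=
      ((tendsto_natCast_atTop_atTop (R := ℝ)).inv_tendsto_atTop.const_mul _).const_add _
        |>.const_mul _
    have h2 := ih.mul h1
    rw [show a ^ j * (a * (1 + ((j : ℝ) + 1) * 0)) = a ^ (j + 1) by ring] at h2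
    refine h2.congr' ?_
    filter_upwards [eventually_ge_atTop 1] with k hk
    have hk0 : (0 : ℝ) < k := by exact_mod_cast hk
    have hk' : (0 : ℝ) < k / a := by positivity
    rw [integral_pow_mul_exp hk', integral_pow_mul_exp hk', integral_pow_mul_exp hk',
      ← add_assoc, Nat.factorial_succ, pow_succ _ (k + j + 1)]
    push_cast
    field_simp
    ring

lemma integrableOn_pow_mul_exp_mul_eval {r : ℝ} (hr : 0 < r) (k : ℕ) (Q : Polynomial ℝ) :
    IntegrableOn (fun t : ℝ => t ^ k * Real.exp (-(t * r)) * Q.eval t) (Ioi 0) := by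
  induction Q using Polynomial.induction_on' with
  | add P Q hP hQ =>
    refine (hP.add hQ).congr (Eventually.of_forall fun t => ?_)
    simp only [Pi.add_apply, Polynomial.eval_add, mul_add]
  | monomial j c =>
    refine ((integrableOn_pow_mul_exp hr (k + j)).const_mul c).congr
      (Eventually.of_forall fun t => ?_)
    simp only [Polynomial.eval_monomial]
    ring

/-- The Gamma laws of `tendsto_gamma_moment`, tested against polynomials. -/
lemma tendsto_gamma_eval {a : ℝ} (ha : 0 < a) (Q : Polynomial ℝ) :
    Tendsto (fun k : ℕ => (∫ t in Ioi (0 : ℝ), t ^ k * Real.exp (-(t * (k / a))) * Q.eval t) /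
      ∫ t in Ioi (0 : ℝ), t ^ k * Real.exp (-(t * (k / a)))) atTop (𝓝 (Q.eval a)) := by
  induction Q using Polynomial.induction_on' with
  | add P Q hP hQ =>
    rw [Polynomial.eval_add]
    refine (hP.add hQ).congr' ?_
    filter_upwards [eventually_ge_atTop 1] with k hk
    have hr : (0 : ℝ) < k / a := div_pos (by exact_mod_cast hk) ha
    rw [← add_div, ← integral_add (integrableOn_pow_mul_exp_mul_eval hr k P)
      (integrableOn_pow_mul_exp_mul_eval hr k Q)]
    simp only [Polynomial.eval_add, mul_add]
  | monomial j c =>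
    rw [Polynomial.eval_monomial]
    refine ((tendsto_gamma_moment ha j).const_mul c).congr fun k => ?_
    rw [← mul_div_assoc, ← integral_const_mul]
    congr 2
    ext t
    rw [Polynomial.eval_monomial]
    ring

/-- Post's inversion argument: the quantities `∫ t^k e^{-tx} φ(t) dt` at `x = k / a`, once
normalized, converge to `φ a`. -/
lemma nonneg_of_laplace_moments_nonneg {φ : ℝ → ℝ} (hc : ContinuousOn φ (Ioi 0)) {C : ℝ} {M : ℕ}
    (hb : ∀ t : ℝ, 0 < t → |φ t| ≤ C * (1 + t ^ M))
    (hφ : ∀ x : ℝ, 0 < x → IntegrableOn (fun t : ℝ => Real.exp (-(t * x)) * φ t) (Ioi 0))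
    (H : ∀ (k : ℕ) (x : ℝ), 0 < x → 0 ≤ ∫ t in Ioi (0 : ℝ), t ^ k * (Real.exp (-(t * x)) * φ t))
    {a : ℝ} (ha : 0 < a) : 0 ≤ φ a := by
  by_contra! hneg
  set η := -φ a / 2 with hη
  have hη0 : 0 < η := by rw [hη]; linarith
  have hC : 0 ≤ C := by
    have := (abs_nonneg _).trans (hb 1 one_pos)
    norm_num at this
    linarith
  -- `φ` is dominated by `-η` plus a polynomial that vanishes to second order at `a`
  obtain ⟨D, hD⟩ : ∃ D : ℝ, ∀ t : ℝ, 0 < t → φ t ≤ -η + D * ((1 + t ^ M) * (t - a) ^ 2) := by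
    have hev : ∀ᶠ t in 𝓝 a, φ t < -η :=
      (hc.continuousAt (Ioi_mem_nhds ha)).eventually_lt_const (by rw [hη]; linarith)
    obtain ⟨δ, hδ, hball⟩ := Metric.eventually_nhds_iff.1 hev
    refine ⟨(C + η) / δ ^ 2, fun t ht => ?_⟩
    rcases lt_or_ge (dist t a) δ with h1 | h1
    · have := hball h1
      have : 0 ≤ (C + η) / δ ^ 2 * ((1 + t ^ M) * (t - a) ^ 2) := by positivity
      linarith
    · have h2 : δ ^ 2 ≤ (t - a) ^ 2 := by
        rw [← sq_abs (t - a)]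
        exact pow_le_pow_left₀ hδ.le h1 2
      have h3 : (1 : ℝ) ≤ (t - a) ^ 2 / δ ^ 2 := by rwa [one_le_div (by positivity)]
      have h4 : (0 : ℝ) ≤ t ^ M := by positivity
      calc φ t ≤ C * (1 + t ^ M) := (le_abs_self _).trans (hb t ht)
        _ ≤ -η + (C + η) * (1 + t ^ M) := by nlinarith
        _ ≤ -η + (C + η) * (1 + t ^ M) * ((t - a) ^ 2 / δ ^ 2) := by
          exact add_le_add_right (le_mul_of_one_le_right (by positivity) h3) _
        _ = _ := by ring
  let Q : Polynomial ℝ := Polynomial.C (-η) +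
    Polynomial.C D * ((1 + Polynomial.X ^ M) * (Polynomial.X - Polynomial.C a) ^ 2)
  have hQ : ∀ t : ℝ, Q.eval t = -η + D * ((1 + t ^ M) * (t - a) ^ 2) := fun t => by simp [Q]
  have hlim := tendsto_gamma_eval ha Q
  have hle : ∀ᶠ k : ℕ in atTop,
      0 ≤ (∫ t in Ioi (0 : ℝ), t ^ k * Real.exp (-(t * (k / a))) * Q.eval t) /
        ∫ t in Ioi (0 : ℝ), t ^ k * Real.exp (-(t * (k / a))) := by
    filter_upwards [eventually_ge_atTop 1] with k hk
    have hr : (0 : ℝ) < k / a := div_pos (by exact_mod_cast hk) ha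
    refine div_nonneg ((H k (k / a) hr).trans (setIntegral_mono_on
      (integrableOn_pow_mul_exp_mul hφ k hr) (integrableOn_pow_mul_exp_mul_eval hr k Q)
      measurableSet_Ioi fun t (ht : 0 < t) => ?_)) ?_
    · rw [hQ, ← mul_assoc]
      exact mul_le_mul_of_nonneg_left (hD t ht) (by positivity)
    · rw [integral_pow_mul_exp hr]
      positivity
  have := ge_of_tendsto hlim hle
  rw [hQ] at this
  simp at this
  linarith

/-! ### The Laplace transform of the weighted Fourier transform -/

lemma summable_Gamma_div_factorial {n y : ℝ} (hn : 0 < n) (hy0 : 0 < y) (hy1 : y < 1) :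
    Summable fun k : ℕ => Real.Gamma (n + k) / k.factorial * y ^ k := by
  have hpos : ∀ k : ℕ, 0 < Real.Gamma (n + k) / k.factorial * y ^ k := fun k => by
    have := Real.Gamma_pos_of_pos (show 0 < n + k by positivity)
    positivity
  refine summable_of_ratio_test_tendsto_lt_one (l := y) hy1
    (Eventually.of_forall fun k => (hpos k).ne') ?_
  have h1 : Tendsto (fun k : ℕ => y * (1 + (n - 1) * ((k : ℝ) + 1)⁻¹)) atTop
      (𝓝 (y * (1 + (n - 1) * 0))) :=
    ((tendsto_atTop_add_const_right _ 1
      (tendsto_natCast_atTop_atTop (R := ℝ))).inv_tendsto_atTop.const_mul _).const_add _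
      |>.const_mul _
  rw [mul_zero, add_zero, mul_one] at h1
  refine h1.congr fun k => ?_
  have h2 := (Real.Gamma_pos_of_pos (show 0 < n + k by positivity)).ne'
  rw [Real.norm_of_nonneg (hpos _).le, Real.norm_of_nonneg (hpos _).le,
    show n + ((k + 1 : ℕ) : ℝ) = n + k + 1 by push_cast; ring,
    Real.Gamma_add_one (by positivity), Nat.factorial_succ, pow_succ]
  push_cast
  field_simp
  ring

/-- The binomial series with a negative exponent, from Euler's integral for `Γ(n + k)`. -/
lemma hasSum_Gamma_div_factorial {n y : ℝ} (hn : 0 < n) (hy0 : 0 < y) (hy1 : y < 1) :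
    HasSum (fun k : ℕ => Real.Gamma (n + k) / k.factorial * (-y) ^ k)
      (Real.Gamma n * (1 / (1 + y)) ^ n) := by
  have hterm : ∀ (k : ℕ), ∀ s ∈ Ioi (0 : ℝ), s ^ (n - 1) * Real.exp (-(s * 1)) *
      ((-(y * s)) ^ k / k.factorial) =
      (-y) ^ k / k.factorial * (s ^ (n + k - 1) * Real.exp (-(s * 1))) := by
    intro k s hs
    rw [show n + (k : ℝ) - 1 = n - 1 + k by ring, Real.rpow_add hs, Real.rpow_natCast,
      show -(y * s) = -y * s by ring, mul_pow]
    ring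
  have hint : ∀ k : ℕ, IntegrableOn (fun s => s ^ (n - 1) * Real.exp (-(s * 1)) *
      ((-(y * s)) ^ k / k.factorial)) (Ioi 0) := by
    intro k
    rw [integrableOn_congr_fun (hterm k) measurableSet_Ioi]
    have hk : (0 : ℝ) ≤ k := k.cast_nonneg
    exact (integrableOn_rpow_mul_exp (by linarith) one_pos).const_mul _
  have hval : ∀ k : ℕ, ∫ s in Ioi (0 : ℝ), s ^ (n + k - 1) * Real.exp (-(s * 1)) =
      Real.Gamma (n + k) := by
    intro k
    have := Real.integral_rpow_mul_exp_neg_mul_Ioi (a := n + k) (by positivity) one_pos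
    simpa using this
  have key := hasSum_integral_of_summable_integral_norm (μ := volume.restrict (Ioi (0 : ℝ))) hint ?_
  · convert! key using 1
    · ext k
      rw [setIntegral_congr_fun measurableSet_Ioi (hterm k), integral_const_mul, hval]
      ring
    · have := Real.integral_rpow_mul_exp_neg_mul_Ioi (a := n) hn (show 0 < 1 + y by linarith)
      rw [mul_comm, ← this]
      refine setIntegral_congr_fun measurableSet_Ioi fun s _ => ?_
      rw [tsum_mul_left, ← congrFun NormedSpace.exp_eq_tsum_div (-(y * s)), ← Real.exp_eq_exp_ℝ,
        mul_assoc, ← Real.exp_add]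
      ring_nf
  · refine (summable_Gamma_div_factorial hn hy0 hy1).congr fun k => ?_
    have : ∀ s ∈ Ioi (0 : ℝ), ‖s ^ (n - 1) * Real.exp (-(s * 1)) *
        ((-(y * s)) ^ k / k.factorial)‖ =
        y ^ k / k.factorial * (s ^ (n + k - 1) * Real.exp (-(s * 1))) := by
      intro s (hs : 0 < s)
      rw [hterm k s hs, norm_mul, norm_div, norm_pow, norm_neg, Real.norm_of_nonneg hy0.le,
        Real.norm_natCast, Real.norm_of_nonneg (by positivity)]
    rw [setIntegral_congr_fun measurableSet_Ioi this, integral_const_mul, hval]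
    ring

lemma integrableOn_exp_mul_rpow_mul_hHat {μ ν : ℝ} (hμ : 0 < μ) (hν : 1 / 2 < ν)
    (hμν : 1 < μ + ν) {x : ℝ} (hx : 0 < x) :
    IntegrableOn (fun t : ℝ => Real.exp (-(t * x)) * (t ^ (2 * ν + μ - 1) * hHat μ ν t))
      (Ioi 0) := by
  have h1 := integrableOn_rpow_mul_exp (a := 2 * ν + μ - 1) (by linarith) hx
  have h2 := h1.mul_bdd (c := ∫ x : ℝ, ‖h μ ν x‖)
    (continuous_hHat hμ hν hμν).aestronglyMeasurable
    (Eventually.of_forall fun t => abs_hHat_le hμ hν hμν t)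
  refine h2.congr (Eventually.of_forall fun t => ?_)
  simp only
  ring

/-- Termwise integration of `hasSum_hHat`; it converges absolutely only for `x > 1`. -/
lemma laplace_rpow_mul_hHat_of_one_lt {μ ν : ℝ} (hμ : 0 < μ) (hν : 1 / 2 < ν)
    (hμν : 1 < μ + ν) {x : ℝ} (hx : 1 < x) :
    laplace (fun t => t ^ (2 * ν + μ - 1) * hHat μ ν t) x =
      Real.Gamma ν ^ 2 * Real.Gamma μ * 2 ^ (2 * ν - 1) / (x ^ μ * (1 + x ^ 2) ^ ν) := by
  have hx0 : 0 < x := by linarith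
  set K := Real.Gamma μ * Real.Gamma ν * 2 ^ (2 * ν - 1) with hK
  have hν0 : 0 < ν := by linarith
  have hK0 : 0 < K := by
    have := Real.Gamma_pos_of_pos hμ
    have := Real.Gamma_pos_of_pos hν0
    positivity
  have hG : ∀ k : ℕ, 0 < Real.Gamma (2 * ν + μ + 2 * k) := fun k =>
    Real.Gamma_pos_of_pos (by positivity)
  have hG' : ∀ k : ℕ, 0 < Real.Gamma (ν + k) := fun k => Real.Gamma_pos_of_pos (by positivity)
  set c : ℕ → ℝ := fun k =>
    Real.Gamma (ν + k) / k.factorial * (-1) ^ k / Real.Gamma (2 * ν + μ + 2 * k) with hc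
  have hterm : ∀ (k : ℕ), ∀ t ∈ Ioi (0 : ℝ), Real.exp (-(t * x)) * (t ^ (2 * ν + μ - 1) *
      (K * c k * t ^ (2 * k))) =
      K * c k * (t ^ (2 * ν + μ + 2 * k - 1) * Real.exp (-(t * x))) := by
    intro k t ht
    rw [show 2 * ν + μ + 2 * (k : ℝ) - 1 = 2 * ν + μ - 1 + (2 * k : ℕ) by push_cast; ring,
      Real.rpow_add ht, Real.rpow_natCast]
    ring
  have hint : ∀ k : ℕ, IntegrableOn (fun t => Real.exp (-(t * x)) * (t ^ (2 * ν + μ - 1) *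
      (K * c k * t ^ (2 * k)))) (Ioi 0) := by
    intro k
    rw [integrableOn_congr_fun (hterm k) measurableSet_Ioi]
    have hk : (0 : ℝ) ≤ k := k.cast_nonneg
    exact (integrableOn_rpow_mul_exp (by linarith) hx0).const_mul _
  have hval : ∀ k : ℕ, ∫ t in Ioi (0 : ℝ), t ^ (2 * ν + μ + 2 * k - 1) * Real.exp (-(t * x)) =
      (1 / x) ^ (2 * ν + μ) * (1 / x ^ 2) ^ k * Real.Gamma (2 * ν + μ + 2 * k) := by
    intro k
    have := Real.integral_rpow_mul_exp_neg_mul_Ioi (a := 2 * ν + μ + 2 * k) (by positivity) hx0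
    simp only [mul_comm x] at this
    rw [this, show 2 * (k : ℝ) = (2 * k : ℕ) by push_cast; ring, Real.rpow_add (by positivity),
      Real.rpow_natCast, pow_mul, one_div_pow]
  have hy0 : 0 < 1 / x ^ 2 := by positivity
  have hy1 : 1 / x ^ 2 < 1 := by
    rw [div_lt_one (by positivity)]
    nlinarith
  have key := hasSum_integral_of_summable_integral_norm (μ := volume.restrict (Ioi (0 : ℝ))) hint ?_
  · have h1 := (hasSum_Gamma_div_factorial hν0 hy0 hy1).mul_left (K * (1 / x) ^ (2 * ν + μ))
    have h2 : laplace (fun t => t ^ (2 * ν + μ - 1) * hHat μ ν t) x =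
        K * (1 / x) ^ (2 * ν + μ) * (Real.Gamma ν * (1 / (1 + 1 / x ^ 2)) ^ ν) := by
      refine HasSum.unique ?_ h1
      convert! key using 1
      · ext k
        rw [setIntegral_congr_fun measurableSet_Ioi (hterm k), integral_const_mul, hval, hc,
          neg_pow (1 / x ^ 2)]
        have := (hG k).ne'
        field_simp
      · rw [laplace]
        congr 1
        ext t
        rw [tsum_mul_left, tsum_mul_left, ← (hasSum_hHat hμ hν hμν t).tsum_eq]
    rw [h2, hK, show 1 / (1 + 1 / x ^ 2) = x ^ 2 / (1 + x ^ 2) by field_simp; ring,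
      Real.div_rpow (sq_nonneg x) (by positivity), one_div,
      Real.inv_rpow hx0.le, Real.rpow_add hx0, Real.rpow_mul hx0.le, Real.rpow_two]
    have h3 : (x ^ 2) ^ ν ≠ 0 := by positivity
    have h4 : (1 + x ^ 2) ^ ν ≠ 0 := by positivity
    have h5 : x ^ μ ≠ 0 := by positivity
    field_simp
  · refine ((summable_Gamma_div_factorial hν0 hy0 hy1).mul_left
      (K * (1 / x) ^ (2 * ν + μ))).congr fun k => ?_
    have hcabs : |c k| = Real.Gamma (ν + k) / k.factorial / Real.Gamma (2 * ν + μ + 2 * k) := by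
      simp only [hc]
      rw [abs_div, abs_mul, abs_div, abs_of_pos (hG k), abs_of_pos (hG' k), Nat.abs_cast, abs_pow]
      simp
    have : ∀ t ∈ Ioi (0 : ℝ), ‖Real.exp (-(t * x)) * (t ^ (2 * ν + μ - 1) *
        (K * c k * t ^ (2 * k)))‖ =
        K * |c k| * (t ^ (2 * ν + μ + 2 * k - 1) * Real.exp (-(t * x))) := by
      intro t (ht : 0 < t)
      rw [hterm k t ht, norm_mul, norm_mul, Real.norm_of_nonneg hK0.le, Real.norm_eq_abs,
        Real.norm_of_nonneg (by positivity)]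
    rw [setIntegral_congr_fun measurableSet_Ioi this, integral_const_mul, hval, hcabs]
    have := (hG k).ne'
    field_simp

/-- The closed form extends from `x > 1`, where the series can be integrated termwise, to `x > 0`,
both sides being holomorphic on the right half-plane. -/
lemma laplace_rpow_mul_hHat {μ ν : ℝ} (hμ : 0 < μ) (hν : 1 / 2 < ν)
    (hμν : 1 < μ + ν) {x : ℝ} (hx : 0 < x) :
    laplace (fun t => t ^ (2 * ν + μ - 1) * hHat μ ν t) x =
      Real.Gamma ν ^ 2 * Real.Gamma μ * 2 ^ (2 * ν - 1) / (x ^ μ * (1 + x ^ 2) ^ ν) := by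
  set K := Real.Gamma ν ^ 2 * Real.Gamma μ * 2 ^ (2 * ν - 1) with hK
  set φ := fun t => t ^ (2 * ν + μ - 1) * hHat μ ν t with hφ
  have hint : ∀ x : ℝ, 0 < x → IntegrableOn (fun t : ℝ => Real.exp (-(t * x)) * φ t) (Ioi 0) :=
    fun x hx => integrableOn_exp_mul_rpow_mul_hHat hμ hν hμν hx
  let U : Set ℂ := {z | 0 < z.re}
  have hUo : IsOpen U := isOpen_lt continuous_const Complex.continuous_re
  have hUc : IsPreconnected U := (convex_halfSpace_re_gt 0).isPreconnected
  let F : ℂ → ℂ := fun z => ∫ t in Ioi (0 : ℝ), (-t : ℂ) ^ 0 * (Complex.exp (-(t * z)) * φ t)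
  let G : ℂ → ℂ := fun z => K / (z ^ (μ : ℂ) * (1 + z ^ 2) ^ (ν : ℂ))
  have hF : AnalyticOnNhd ℂ F U := by
    apply DifferentiableOn.analyticOnNhd _ hUo
    intro z hz
    exact (hasDerivAt_complex_laplace hint 0 hz).differentiableAt.differentiableWithinAt
  have hslit : ∀ z ∈ U, 1 + z ^ 2 ∈ Complex.slitPlane := by
    intro z hz
    have hz : 0 < z.re := hz
    rw [Complex.mem_slitPlane_iff]
    by_cases him : z.im = 0
    · left
      simp [sq, him]
      positivity
    · right
      simp only [sq, Complex.add_im, Complex.one_im, Complex.mul_im]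
      intro h0
      apply him
      have : 2 * z.re * z.im = 0 := by linarith
      simpa [hz.ne'] using this
  have hG : AnalyticOnNhd ℂ G U := by
    apply DifferentiableOn.analyticOnNhd _ hUo
    intro z hz
    have h1 : z ∈ Complex.slitPlane := Or.inl hz
    have h2 := hslit z hz
    apply DifferentiableAt.differentiableWithinAt
    apply DifferentiableAt.div (differentiableAt_const _)
    · exact (differentiableAt_id.cpow_const h1).mul
        (DifferentiableAt.cpow_const (by fun_prop) h2)
    · exact mul_ne_zero (by simp [Complex.cpow_eq_zero_iff, Complex.slitPlane_ne_zero h1])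
        (by simp [Complex.cpow_eq_zero_iff, Complex.slitPlane_ne_zero h2])
  have hFr : ∀ y : ℝ, F y = (laplace φ y : ℂ) := by
    intro y
    simp only [F, laplace]
    rw [← integral_complex_ofReal]
    push_cast
    simp
  have hGr : ∀ y : ℝ, 0 < y → G y = ((K / (y ^ μ * (1 + y ^ 2) ^ ν) : ℝ) : ℂ) := by
    intro y hy
    simp only [G]
    rw [Complex.ofReal_div, Complex.ofReal_mul (y ^ μ), Complex.ofReal_cpow hy.le,
      Complex.ofReal_cpow (by positivity)]
    push_cast
    rfl
  -- the two sides agree at the real points near `2`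
  have hfreq : ∃ᶠ z in 𝓝[≠] (2 : ℂ), F z = G z := by
    have ht : Tendsto (fun y : ℝ => (y : ℂ)) (𝓝[≠] (2 : ℝ)) (𝓝[≠] (2 : ℂ)) := by
      apply tendsto_nhdsWithin_of_tendsto_nhds_of_eventually_within
      · have := (Complex.continuous_ofReal.tendsto (2 : ℝ)).mono_left
          (nhdsWithin_le_nhds (s := {(2 : ℝ)}ᶜ))
        simpa using this
      · filter_upwards [self_mem_nhdsWithin] with y hy
        intro h0
        apply hy
        have : (y : ℂ) = ((2 : ℝ) : ℂ) := by simpa using h0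
        exact Complex.ofReal_injective this
    refine ht.frequently (Eventually.frequently ?_)
    filter_upwards [nhdsWithin_le_nhds (Ioi_mem_nhds (show (1 : ℝ) < 2 by norm_num))] with y hy
    rw [hFr, hGr y (zero_lt_one.trans hy), laplace_rpow_mul_hHat_of_one_lt hμ hν hμν hy]
  have hEq := hF.eqOn_of_preconnected_of_frequently_eq hG hUc
    (show (2 : ℂ) ∈ U by simp [U]) hfreq
  have := hEq (show (x : ℂ) ∈ U by simpa [U])
  rw [hFr, hGr x hx] at this
  exact_mod_cast this

/-! ### Fourier transforms of radial functions -/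

open scoped RealInnerProductSpace FourierTransform

section Radial

variable {V : Type*} [NormedAddCommGroup V] [InnerProductSpace ℝ V] [FiniteDimensional ℝ V]
  [MeasurableSpace V] [BorelSpace V]

/-- Integration in polar coordinates. -/
lemma integral_eq_integral_toSphere [Nontrivial V] {F : V → ℝ} (hF : Integrable F) :
    ∫ x, F x = ∫ r in Ioi (0 : ℝ), r ^ (Module.finrank ℝ V - 1) *
      ∫ σ : Metric.sphere (0 : V) 1, F (r • (σ : V)) ∂(volume : Measure V).toSphere := by
  let G : Metric.sphere (0 : V) 1 × Ioi (0 : ℝ) → ℝ := fun p => F ((p.2 : ℝ) • (p.1 : V))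
  have hG : ∀ x : ({0}ᶜ : Set V), G (homeomorphUnitSphereProd V x) = F x := by
    intro x
    have hx : ‖(x : V)‖ ≠ 0 := norm_ne_zero_iff.2 x.2
    simp only [G, homeomorphUnitSphereProd_apply_fst_coe, homeomorphUnitSphereProd_apply_snd_coe]
    rw [smul_smul, mul_inv_cancel₀ hx, one_smul]
  have hmp := (volume : Measure V).measurePreserving_homeomorphUnitSphereProd
  have hemb := (homeomorphUnitSphereProd V).measurableEmbedding
  have hGi : Integrable G ((volume : Measure V).toSphere.prod
      (.volumeIoiPow (Module.finrank ℝ V - 1))) := by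
    rw [← hmp.integrable_comp_emb hemb]
    have : G ∘ homeomorphUnitSphereProd V = F ∘ ((↑) : ({0}ᶜ : Set V) → V) := funext hG
    rw [this, ← integrableOn_iff_comap_subtypeVal (measurableSet_singleton _).compl]
    exact hF.integrableOn
  calc ∫ x, F x = ∫ x : ({0}ᶜ : Set V), F x ∂((volume : Measure V).comap (↑)) := by
        rw [integral_subtype_comap (measurableSet_singleton _).compl F, restrict_compl_singleton]
    _ = ∫ p, G p ∂((volume : Measure V).toSphere.prod
          (.volumeIoiPow (Module.finrank ℝ V - 1))) := by
        rw [← hmp.integral_comp hemb G]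
        simp only [hG]
    _ = ∫ r : Ioi (0 : ℝ), (∫ σ, G (σ, r) ∂(volume : Measure V).toSphere)
          ∂(.volumeIoiPow (Module.finrank ℝ V - 1)) := integral_prod_symm G hGi
    _ = _ := by
        simp only [Measure.volumeIoiPow, ENNReal.ofReal, G]
        rw [integral_withDensity_eq_integral_smul
            (measurable_subtype_coe.pow_const _).real_toNNReal,
          integral_subtype_comap measurableSet_Ioi fun r : ℝ =>
            Real.toNNReal (r ^ (Module.finrank ℝ V - 1)) •
              ∫ σ : Metric.sphere (0 : V) 1, F (r • (σ : V)) ∂(volume : Measure V).toSphere,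
          setIntegral_congr_fun measurableSet_Ioi fun r hr => ?_]
        rw [NNReal.smul_def, Real.coe_toNNReal _ (pow_nonneg (le_of_lt hr) _), smul_eq_mul]

/-- The moment generating function of the Gaussian weight `exp (-‖v‖²)`. -/
lemma integral_rexp_neg_sq_norm_add (c : ℝ) (w : V) :
    ∫ v : V, Real.exp (-‖v‖ ^ 2 + c * ⟪w, v⟫) =
      Real.pi ^ ((Module.finrank ℝ V : ℝ) / 2) * Real.exp (c ^ 2 * (‖w‖ ^ 2 / 4)) := by
  have := GaussianFourier.integral_cexp_neg_mul_sq_norm_add (b := 1) (by simp) (c : ℂ) w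
  apply Complex.ofReal_injective
  rw [← integral_complex_ofReal, Complex.ofReal_mul, Complex.ofReal_cpow Real.pi_pos.le]
  push_cast
  convert! this using 3
  · simp
  · simp
  · ring_nf

lemma integrable_rexp_neg_sq_norm_add (c : ℝ) (w : V) :
    Integrable fun v : V => Real.exp (-‖v‖ ^ 2 + c * ⟪w, v⟫) := by
  have := (GaussianFourier.integrable_cexp_neg_mul_sq_norm_add (b := 1) (by simp) (c : ℂ) w).re
  refine this.congr (Eventually.of_forall fun v => ?_)
  have e : -(1 : ℂ) * (‖v‖ : ℂ) ^ 2 + c * (⟪w, v⟫ : ℂ) =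
      ((-‖v‖ ^ 2 + c * ⟪w, v⟫ : ℝ) : ℂ) := by push_cast; ring
  simp only [e, ← Complex.ofReal_exp]
  rfl

/-- Uniqueness of the coefficients of an everywhere convergent power series. -/
lemma eq_of_hasSum_pow {a b : ℕ → ℝ} {F : ℝ → ℝ} (ha : ∀ x, HasSum (fun k => a k * x ^ k) (F x))
    (hb : ∀ x, HasSum (fun k => b k * x ^ k) (F x)) : a = b := by
  have key : ∀ c : ℕ → ℝ, (∀ x, HasSum (fun k => c k * x ^ k) (F x)) →
      HasFPowerSeriesAt F (FormalMultilinearSeries.ofScalars ℝ c) 0 := by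
    intro c hc
    rw [hasFPowerSeriesAt_iff]
    refine Eventually.of_forall fun z => ?_
    simpa [FormalMultilinearSeries.coeff_ofScalars, mul_comm] using hc z
  exact FormalMultilinearSeries.ofScalars_series_injective ℝ ℝ
    ((key a ha).eq_formalMultilinearSeries (key b hb))

lemma integrable_exp_mul_inner_pow (w : V) (k : ℕ) :
    Integrable fun v : V => Real.exp (-‖v‖ ^ 2) * ⟪w, v⟫ ^ k := by
  have h1 := (integrable_rexp_neg_sq_norm_add 1 w).add (integrable_rexp_neg_sq_norm_add (-1) w)
  refine (h1.const_mul (k.factorial : ℝ)).mono' (Continuous.aestronglyMeasurable (by fun_prop))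
    (Eventually.of_forall fun v => ?_)
  have h2 := Real.pow_div_factorial_le_exp |⟪w, v⟫| (abs_nonneg _) k
  rw [div_le_iff₀' (by positivity)] at h2
  have h3 : Real.exp |⟪w, v⟫| ≤ Real.exp ⟪w, v⟫ + Real.exp (-⟪w, v⟫) := by
    rcases abs_choice ⟪w, v⟫ with h | h <;> rw [h] <;>
      linarith [Real.exp_pos ⟪w, v⟫, Real.exp_pos (-⟪w, v⟫)]
  rw [norm_mul, norm_pow, Real.norm_of_nonneg (Real.exp_pos _).le, Real.norm_eq_abs, Pi.add_apply,
    Real.exp_add, Real.exp_add, one_mul, neg_one_mul]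
  calc _ ≤ Real.exp (-‖v‖ ^ 2) * (k.factorial * (Real.exp ⟪w, v⟫ + Real.exp (-⟪w, v⟫))) := by
        gcongr
        exact h2.trans (by gcongr)
    _ = _ := by ring

/-- Even Gaussian moments, read off from the moment generating function. -/
lemma integral_exp_mul_inner_pow (w : V) (j : ℕ) :
    ∫ v : V, Real.exp (-‖v‖ ^ 2) * ⟪w, v⟫ ^ (2 * j) =
      Real.pi ^ ((Module.finrank ℝ V : ℝ) / 2) * (2 * j).factorial * (‖w‖ ^ 2 / 4) ^ j /
        j.factorial := by
  set P := Real.pi ^ ((Module.finrank ℝ V : ℝ) / 2) with hP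
  let a : ℕ → ℝ := fun k => (∫ v : V, Real.exp (-‖v‖ ^ 2) * ⟪w, v⟫ ^ k) / k.factorial
  let b : ℕ → ℝ := fun k => if Even k then P * (‖w‖ ^ 2 / 4) ^ (k / 2) / (k / 2).factorial else 0
  let F : ℝ → ℝ := fun c => P * Real.exp (c ^ 2 * (‖w‖ ^ 2 / 4))
  have ha : ∀ c, HasSum (fun k => a k * c ^ k) (F c) := by
    intro c
    have hexp : ∀ x : ℝ, HasSum (fun k : ℕ => x ^ k / k.factorial) (Real.exp x) := by
      intro x
      rw [Real.exp_eq_exp_ℝ]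
      exact NormedSpace.expSeries_div_hasSum_exp x
    have key := hasSum_integral_of_dominated_convergence (μ := (volume : Measure V))
      (F := fun (k : ℕ) v => Real.exp (-‖v‖ ^ 2) * ((c * ⟪w, v⟫) ^ k / k.factorial))
      (f := fun v => Real.exp (-‖v‖ ^ 2 + c * ⟪w, v⟫))
      (fun k v => Real.exp (-‖v‖ ^ 2) * (|c * ⟪w, v⟫| ^ k / k.factorial))
      (fun k => Continuous.aestronglyMeasurable (by fun_prop))
      (fun k => Eventually.of_forall fun v => ?_)
      (Eventually.of_forall fun v => (hexp _).summable.mul_left _) ?_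
      (Eventually.of_forall fun v => ?_)
    · rw [integral_rexp_neg_sq_norm_add] at key
      convert! key using 1
      ext k
      simp only [a]
      rw [div_mul_eq_mul_div, ← integral_mul_const, ← integral_div]
      congr 1
      ext v
      rw [mul_pow]
      ring
    · rw [norm_mul, norm_div, norm_pow, Real.norm_of_nonneg (Real.exp_pos _).le,
        Real.norm_eq_abs, Real.norm_natCast]
    · have h1 := (integrable_rexp_neg_sq_norm_add c w).add (integrable_rexp_neg_sq_norm_add (-c) w)
      simp_rw [tsum_mul_left, (hexp _).tsum_eq]
      refine h1.mono' (Continuous.aestronglyMeasurable (by fun_prop))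
        (Eventually.of_forall fun v => ?_)
      rw [Real.norm_of_nonneg (by positivity), Pi.add_apply, Real.exp_add, Real.exp_add, ← mul_add]
      gcongr
      rcases abs_choice (c * ⟪w, v⟫) with h | h <;> rw [h, neg_mul] <;>
        linarith [Real.exp_pos (c * ⟪w, v⟫), Real.exp_pos (-(c * ⟪w, v⟫))]
    · rw [Real.exp_add]
      exact (hexp _).mul_left _
  have hb : ∀ c, HasSum (fun k => b k * c ^ k) (F c) := by
    intro c
    have hinj : Function.Injective fun j : ℕ => 2 * j := fun x y h => by simpa using h
    rw [← hinj.hasSum_iff]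
    · have h1 : HasSum (fun k : ℕ => (c ^ 2 * (‖w‖ ^ 2 / 4)) ^ k / k.factorial)
          (Real.exp (c ^ 2 * (‖w‖ ^ 2 / 4))) := by
        rw [Real.exp_eq_exp_ℝ]
        exact NormedSpace.expSeries_div_hasSum_exp _
      convert! h1.mul_left P using 1
      ext k
      simp only [b, Function.comp_apply, even_two, Even.mul_right, if_true]
      rw [Nat.mul_div_cancel_left k two_pos, mul_pow, pow_mul]
      ring
    · intro k hk
      have : ¬ Even k := by
        rintro ⟨r, rfl⟩
        exact hk ⟨r, by simp; ring⟩
      simp [b, this]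
  have := congrFun (eq_of_hasSum_pow ha hb) (2 * j)
  simp only [a, b, even_two, Even.mul_right, if_true] at this
  rw [Nat.mul_div_cancel_left j two_pos, div_eq_iff (by positivity)] at this
  rw [this]
  ring

/-- Even moments of the surface measure of the unit sphere: the radial factor of the Gaussian
moments is divided out. -/
lemma integral_toSphere_inner_pow [Nontrivial V] (w : V) (j : ℕ) :
    ∫ σ : Metric.sphere (0 : V) 1, ⟪w, (σ : V)⟫ ^ (2 * j) ∂(volume : Measure V).toSphere =
      2 * Real.pi ^ ((Module.finrank ℝ V : ℝ) / 2) * (2 * j).factorial * (‖w‖ ^ 2 / 4) ^ j /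
        (j.factorial * Real.Gamma (j + (Module.finrank ℝ V : ℝ) / 2)) := by
  have hd : 1 ≤ Module.finrank ℝ V := Module.finrank_pos
  set d := Module.finrank ℝ V with hd'
  set S := ∫ σ : Metric.sphere (0 : V) 1, ⟪w, (σ : V)⟫ ^ (2 * j) ∂(volume : Measure V).toSphere
  have h1 := integral_eq_integral_toSphere (integrable_exp_mul_inner_pow w (2 * j))
  rw [integral_exp_mul_inner_pow] at h1
  have h2 : ∀ r ∈ Ioi (0 : ℝ), r ^ (d - 1) * ∫ σ : Metric.sphere (0 : V) 1,
      Real.exp (-‖r • (σ : V)‖ ^ 2) * ⟪w, r • (σ : V)⟫ ^ (2 * j) ∂(volume : Measure V).toSphere =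
      r ^ ((d : ℝ) - 1 + 2 * j) * Real.exp (-r ^ (2 : ℝ)) * S := by
    intro r (hr : 0 < r)
    have h3 : ∀ σ : Metric.sphere (0 : V) 1,
        Real.exp (-‖r • (σ : V)‖ ^ 2) * ⟪w, r • (σ : V)⟫ ^ (2 * j) =
          r ^ (2 * j) * Real.exp (-r ^ (2 : ℝ)) * ⟪w, (σ : V)⟫ ^ (2 * j) := by
      intro σ
      rw [norm_smul, norm_eq_of_mem_sphere σ, mul_one, Real.norm_of_nonneg hr.le,
        real_inner_smul_right, mul_pow, Real.rpow_two]
      ring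
    simp_rw [h3]
    rw [integral_const_mul, show (d : ℝ) - 1 + 2 * j = ((d - 1 + 2 * j : ℕ) : ℝ) by
      push_cast [Nat.cast_sub hd]; ring, Real.rpow_natCast, pow_add]
    ring
  have hdj : 0 < (j : ℝ) + (d : ℝ) / 2 := by positivity
  have h4 := Real.Gamma_pos_of_pos hdj
  have hd1 : (1 : ℝ) ≤ d := by exact_mod_cast hd
  have hj0 : (0 : ℝ) ≤ j := j.cast_nonneg
  rw [setIntegral_congr_fun measurableSet_Ioi h2, integral_mul_const,
    integral_rpow_mul_exp_neg_rpow two_pos (by linarith),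
    show ((d : ℝ) - 1 + 2 * j + 1) / 2 = j + d / 2 by ring] at h1
  rw [eq_div_iff (by positivity)]
  have hj : (j.factorial : ℝ) ≠ 0 := by positivity
  rw [← hd'] at h1
  generalize Real.Gamma (j + (d : ℝ) / 2) = G at h1 ⊢
  field_simp at h1
  linarith

/-- The Fourier transform of the surface measure of the unit sphere. -/
lemma integral_toSphere_cos_inner [Nontrivial V] (w : V) :
    ∫ σ : Metric.sphere (0 : V) 1, Real.cos ⟪w, (σ : V)⟫ ∂(volume : Measure V).toSphere =
      (2 * Real.pi) ^ ((Module.finrank ℝ V : ℝ) / 2) *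
        besselj ((Module.finrank ℝ V : ℝ) / 2 - 1) ‖w‖ := by
  have hd : 1 ≤ Module.finrank ℝ V := Module.finrank_pos
  set d := Module.finrank ℝ V with hd'
  have hd1 : (1 : ℝ) ≤ d := by exact_mod_cast hd
  have hinner : ∀ σ : Metric.sphere (0 : V) 1, |⟪w, (σ : V)⟫| ≤ ‖w‖ := by
    intro σ
    simpa [norm_eq_of_mem_sphere σ] using abs_real_inner_le_norm w (σ : V)
  have hsum : ∀ x : ℝ, Summable fun k : ℕ => |x| ^ (2 * k) / ((2 * k).factorial : ℝ) := fun x =>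
    (Real.hasSum_cosh |x|).summable
  have key := hasSum_integral_of_dominated_convergence (μ := (volume : Measure V).toSphere)
    (F := fun (k : ℕ) σ => (-1) ^ k * ⟪w, (σ : V)⟫ ^ (2 * k) / ((2 * k).factorial : ℝ))
    (f := fun σ => Real.cos ⟪w, (σ : V)⟫)
    (fun k _ => |‖w‖| ^ (2 * k) / ((2 * k).factorial : ℝ))
    (fun k => Continuous.aestronglyMeasurable (by fun_prop))
    (fun k => Eventually.of_forall fun σ => ?_)
    (Eventually.of_forall fun σ => hsum _) (integrable_const _)
    (Eventually.of_forall fun σ => Real.hasSum_cos _)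
  · refine key.unique ?_
    convert! (hasSum_besselj (l := (d : ℝ) / 2 - 1) (by linarith) ‖w‖).mul_left
      ((2 * Real.pi) ^ ((d : ℝ) / 2)) using 1
    ext k
    rw [integral_div, integral_const_mul, integral_toSphere_inner_pow, besselCoeff,
      Real.mul_rpow zero_le_two Real.pi_pos.le, Real.rpow_sub two_pos, Real.rpow_one,
      show (k : ℝ) + ((d : ℝ) / 2 - 1) + 1 = k + d / 2 by ring, div_pow, div_pow, pow_mul]
    have h1 : (2 : ℝ) ^ ((d : ℝ) / 2) ≠ 0 := by positivity
    have h2 := (Real.Gamma_pos_of_pos (show 0 < (k : ℝ) + (d : ℝ) / 2 by positivity)).ne'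
    have h3 : ((2 * k).factorial : ℝ) ≠ 0 := by positivity
    rw [← hd']
    generalize Real.Gamma (k + (d : ℝ) / 2) = G at h2 ⊢
    field_simp
  · rw [norm_div, norm_mul, norm_pow, norm_pow, norm_neg, norm_one, one_pow, one_mul,
      Real.norm_eq_abs, Real.norm_natCast, abs_of_nonneg (norm_nonneg w)]
    gcongr
    exact hinner σ

/-- The Fourier transform of a radial function is a Hankel transform. -/
lemma integral_radial_mul_cos [Nontrivial V] {φ : ℝ → ℝ} (hφ : Integrable fun x : V => φ ‖x‖)
    (w : V) :
    ∫ x : V, φ ‖x‖ * Real.cos ⟪w, x⟫ =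
      (2 * Real.pi) ^ ((Module.finrank ℝ V : ℝ) / 2) * hankel (Module.finrank ℝ V) φ ‖w‖ := by
  have hd : 1 ≤ Module.finrank ℝ V := Module.finrank_pos
  have hint : Integrable fun x : V => φ ‖x‖ * Real.cos ⟪w, x⟫ :=
    hφ.mul_bdd (c := 1) (Continuous.aestronglyMeasurable (by fun_prop))
      (Eventually.of_forall fun x => Real.abs_cos_le_one _)
  rw [integral_eq_integral_toSphere hint, hankel, ← integral_const_mul]
  refine setIntegral_congr_fun measurableSet_Ioi fun r (hr : 0 < r) => ?_
  have h1 : ∀ σ : Metric.sphere (0 : V) 1, φ ‖r • (σ : V)‖ * Real.cos ⟪w, r • (σ : V)⟫ =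
      φ r * Real.cos ⟪r • w, (σ : V)⟫ := by
    intro σ
    rw [norm_smul, norm_eq_of_mem_sphere σ, mul_one, Real.norm_of_nonneg hr.le,
      real_inner_smul_right, real_inner_smul_left]
  simp_rw [h1]
  rw [integral_const_mul, integral_toSphere_cos_inner, norm_smul, Real.norm_of_nonneg hr.le,
    mul_comm ‖w‖ r, show ((Module.finrank ℝ V : ℝ) - 1) = ((Module.finrank ℝ V - 1 : ℕ) : ℝ) by
      push_cast [Nat.cast_sub hd]; ring, Real.rpow_natCast]
  ring

end Radial

/-! ### Bochner's theorem for compactly supported functions -/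

/-- A kernel whose double sums over finite families of points are nonnegative has nonnegative mean:
average the double sums over `N` independent points. The diagonal contributes `N` terms and
the rest `N² - N`, so the mean over independent pairs is nonnegative in the limit. -/
lemma integral_prod_nonneg_of_kernel_nonneg {α : Type*} [MeasurableSpace α] {P : Measure α}
    [IsProbabilityMeasure P] {K : α × α → ℝ} (hK : Integrable K (P.prod P))
    (hKd : Integrable (fun x => K (x, x)) P)
    (hpos : ∀ (N : ℕ) (x : Fin N → α), 0 ≤ ∑ i, ∑ j, K (x i, x j)) :
    0 ≤ ∫ p, K p ∂(P.prod P) := by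
  set J := ∫ p, K p ∂(P.prod P) with hJ
  set D := ∫ x, K (x, x) ∂P with hD
  have hN : ∀ N : ℕ, 0 ≤ (N : ℝ) * D + ((N : ℝ) * N - N) * J := by
    intro N
    let Q : Measure (Fin N → α) := Measure.pi fun _ => P
    have hev : ∀ i : Fin N, MeasurePreserving (fun x : Fin N → α => x i) Q P := fun i =>
      measurePreserving_eval (fun _ : Fin N => P) i
    have hpair : ∀ i j : Fin N, i ≠ j →
        MeasurePreserving (fun x : Fin N → α => (x i, x j)) Q (P.prod P) := by
      intro i j hij
      have hind := (ProbabilityTheory.iIndepFun_pi (μ := fun _ : Fin N => P)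
        (X := fun _ x => x) (fun _ => aemeasurable_id)).indepFun hij
      have := hind.map_prod_eq_prod_map_map (hev i).measurable.aemeasurable
        (hev j).measurable.aemeasurable
      refine ⟨(hev i).measurable.prodMk (hev j).measurable, ?_⟩
      rw [(hev i).map_eq, (hev j).map_eq] at this
      exact this
    have hterm : ∀ i j : Fin N, Integrable (fun x : Fin N → α => K (x i, x j)) Q ∧
        ∫ x, K (x i, x j) ∂Q = if i = j then D else J := by
      intro i j
      by_cases hij : i = j
      · subst hij
        rw [if_pos rfl]
        refine ⟨(hev i).integrable_comp_of_integrable hKd, ?_⟩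
        have h1 := integral_map (hev i).measurable.aemeasurable
          (f := fun x => K (x, x)) (by rw [(hev i).map_eq]; exact hKd.aestronglyMeasurable)
        rw [(hev i).map_eq] at h1
        exact h1.symm
      · rw [if_neg hij]
        refine ⟨(hpair i j hij).integrable_comp_of_integrable hK, ?_⟩
        have h1 := integral_map (hpair i j hij).measurable.aemeasurable
          (f := K) (by rw [(hpair i j hij).map_eq]; exact hK.aestronglyMeasurable)
        rw [(hpair i j hij).map_eq] at h1
        exact h1.symm
    have h0 : 0 ≤ ∫ x, ∑ i, ∑ j, K (x i, x j) ∂Q := integral_nonneg fun x => hpos N x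
    rw [integral_finsetSum _ fun i _ => integrable_finsetSum _ fun j _ => (hterm i j).1] at h0
    simp_rw [integral_finsetSum _ fun j _ => (hterm _ j).1, (hterm _ _).2] at h0
    have h1 : ∀ i : Fin N, ∑ j : Fin N, (if i = j then D else J) = D + ((N : ℝ) - 1) * J := by
      intro i
      have : ∀ j : Fin N, (if i = j then D else J) = (if i = j then D - J else 0) + J := by
        intro j
        split_ifs <;> ring
      simp_rw [this]
      rw [Finset.sum_add_distrib, Finset.sum_ite_eq]
      simp
      ring
    simp_rw [h1] at h0
    simp at h0
    linarith
  by_contra! hJneg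
  -- `N + 1` points with `D + N J < 0`
  obtain ⟨N, hNl⟩ := exists_nat_gt ((D - J) / (-J))
  rw [div_lt_iff₀ (by linarith)] at hNl
  have h1 := hN (N + 1)
  push_cast at h1
  have h2 : (0 : ℝ) ≤ N := N.cast_nonneg
  have h3 : 0 ≤ ((N : ℝ) + 1) * (D + N * J) := by linarith
  have h4 := nonneg_of_mul_nonneg_right h3 (by positivity)
  linarith

section

variable {V : Type*} [NormedAddCommGroup V] [InnerProductSpace ℝ V] [FiniteDimensional ℝ V]
  [MeasurableSpace V] [BorelSpace V]

/-- A compactly supported function for which all double sums of differences are nonnegative has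
nonnegative integral: compare the integral with the average over pairs of points of a large ball. -/
lemma integral_nonneg_of_sum_sub_nonneg [Nontrivial V] {ψ : V → ℝ} (hc : Continuous ψ)
    (hs : HasCompactSupport ψ)
    (hpos : ∀ (N : ℕ) (x : Fin N → V), 0 ≤ ∑ i, ∑ j, ψ (x i - x j)) : 0 ≤ ∫ x, ψ x := by
  have hint : Integrable ψ := hc.integrable_of_hasCompactSupport hs
  obtain ⟨C, hC⟩ := hs.exists_bound_of_continuous hc
  obtain ⟨ρ, hρ0, hρ⟩ : ∃ ρ : ℝ, 0 < ρ ∧ ∀ x, ρ ≤ ‖x‖ → ψ x = 0 := by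
    obtain ⟨ρ, hρ0, hρ⟩ := hs.isCompact.isBounded.subset_ball_lt 0 0
    refine ⟨ρ, hρ0, fun x hx => ?_⟩
    by_contra hne
    have := hρ (subset_tsupport ψ hne)
    rw [mem_ball_zero_iff] at this
    linarith
  set d := Module.finrank ℝ V with hd
  set A := ∫ x, ψ x with hA
  set B := ∫ x, ‖ψ x‖ with hB
  set v := (volume : Measure V).real (Metric.ball 0 1) with hv
  have hv0 : 0 < v := by
    rw [hv, measureReal_def]
    exact ENNReal.toReal_pos (Metric.measure_ball_pos _ _ one_pos).ne' measure_ball_lt_top.ne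
  have hball : ∀ r : ℝ, 0 ≤ r → (volume : Measure V).real (Metric.ball 0 r) = r ^ d * v := by
    intro r hr
    rw [← Measure.addHaar_real_closedBall_eq_addHaar_real_ball,
      Measure.addHaar_real_closedBall _ _ hr]
  -- for `y` in the ball of radius `R - ρ`, integrating `ψ (x - y)` over the ball of radius `R`
  -- gives the full integral `A`; for the other `y` it gives at most `B`
  have hR : ∀ R : ℝ, ρ < R → 0 ≤ (R - ρ) ^ d * A + (R ^ d - (R - ρ) ^ d) * B := by
    intro R hRρ
    set b := Metric.ball (0 : V) R with hb
    have hbfin : (volume : Measure V) b ≠ ⊤ := measure_ball_lt_top.ne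
    have hb0 : (volume : Measure V) b ≠ 0 := (Metric.measure_ball_pos _ _ (by linarith)).ne'
    let P : Measure V := ProbabilityTheory.cond volume b
    have : IsProbabilityMeasure P := ProbabilityTheory.cond_isProbabilityMeasure_of_finite hb0 hbfin
    have hKint : Integrable (fun p : V × V => ψ (p.1 - p.2)) (P.prod P) :=
      Integrable.of_bound (C := C) (Continuous.aestronglyMeasurable (by fun_prop))
        (Eventually.of_forall fun p => hC _)
    have h1 := integral_prod_nonneg_of_kernel_nonneg hKint
      (by simp) hpos
    -- `P` is normalized Lebesgue measure, so the normalizing factor comes out squared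
    rw [integral_prod_symm _ hKint] at h1
    simp only [P, ProbabilityTheory.cond, integral_smul_measure] at h1
    rw [integral_smul, ← smul_assoc, smul_eq_mul (a := ENNReal.toReal _)] at h1
    have hpos' : 0 < ((volume : Measure V) b)⁻¹.toReal :=
      ENNReal.toReal_pos (ENNReal.inv_ne_zero.2 hbfin) (ENNReal.inv_ne_top.2 hb0)
    have h2 : 0 ≤ ∫ y in b, ∫ x in b, ψ (x - y) :=
      nonneg_of_mul_nonneg_right (by simpa using h1) (mul_pos hpos' hpos')
    set b' := Metric.ball (0 : V) (R - ρ) with hb'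
    have hsub : b' ⊆ b := Metric.ball_subset_ball (by linarith)
    have htrans : ∀ y : V, Integrable fun x => ψ (x - y) := fun y => hint.comp_sub_right y
    have hinner : ∀ y, ∫ x in b, ψ (x - y) ≤ (b'.indicator (fun _ => A - B) y) + B := by
      intro y
      by_cases hy : y ∈ b'
      · rw [indicator_of_mem hy, sub_add_cancel, setIntegral_eq_integral_of_forall_compl_eq_zero,
          integral_sub_right_eq_self (fun x => ψ x)]
        intro x hx
        apply hρ
        rw [hb, mem_ball_zero_iff, not_lt] at hx
        rw [hb', mem_ball_zero_iff] at hy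
        linarith [norm_sub_norm_le x y]
      · rw [indicator_of_notMem hy, zero_add]
        calc ∫ x in b, ψ (x - y) ≤ ∫ x in b, ‖ψ (x - y)‖ :=
              integral_mono (htrans y).integrableOn (htrans y).norm.integrableOn
                fun x => Real.le_norm_self _
          _ ≤ ∫ x, ‖ψ (x - y)‖ := setIntegral_le_integral (htrans y).norm
              (Eventually.of_forall fun x => norm_nonneg _)
          _ = B := integral_sub_right_eq_self (fun x => ‖ψ x‖) y
    have hprod : Integrable (fun p : V × V => ψ (p.1 - p.2))
        ((volume.restrict b).prod (volume.restrict b)) := by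
      have : IsFiniteMeasure (volume.restrict b) := ⟨by simpa using hbfin.lt_top⟩
      exact Integrable.of_bound (C := C) (Continuous.aestronglyMeasurable (by fun_prop))
        (Eventually.of_forall fun p => hC _)
    have hconst : ∀ c : ℝ, IntegrableOn (fun _ : V => c) b := fun c =>
      integrableOn_const hbfin
    have hmb' : MeasurableSet b' := Metric.isOpen_ball.measurableSet
    have h3 : ∫ y in b, ∫ x in b, ψ (x - y) ≤
        ∫ y in b, ((b'.indicator (fun _ => A - B) y) + B) :=
      integral_mono hprod.integral_prod_right (((hconst _).indicator hmb').add (hconst _)) hinner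
    rw [integral_add ((hconst _).indicator hmb') (hconst _), setIntegral_indicator hmb',
      inter_eq_right.2 hsub, setIntegral_const, setIntegral_const, hb, hb', hball _ (by linarith),
      hball _ (by linarith), smul_eq_mul, smul_eq_mul] at h3
    have h4 : 0 ≤ v * ((R - ρ) ^ d * A + (R ^ d - (R - ρ) ^ d) * B) := by linarith
    exact nonneg_of_mul_nonneg_right h4 hv0
  have hlim : Tendsto (fun R : ℝ => (1 - ρ * R⁻¹) ^ d * A + (1 - (1 - ρ * R⁻¹) ^ d) * B) atTop
      (𝓝 ((1 - ρ * 0) ^ d * A + (1 - (1 - ρ * 0) ^ d) * B)) := by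
    have h1 : Tendsto (fun R : ℝ => (1 - ρ * R⁻¹) ^ d) atTop (𝓝 ((1 - ρ * 0) ^ d)) :=
      ((tendsto_inv_atTop_zero.const_mul ρ).const_sub 1).pow d
    exact (h1.mul_const A).add ((h1.const_sub 1).mul_const B)
  have : (1 - ρ * 0) ^ d * A + (1 - (1 - ρ * 0) ^ d) * B = A := by simp
  rw [this] at hlim
  refine ge_of_tendsto hlim ?_
  filter_upwards [eventually_gt_atTop ρ] with R hRρ
  have hR0 : 0 < R := hρ0.trans hRρ
  have h1 := div_nonneg (hR R hRρ) (pow_pos hR0 d).le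
  have h2 : 1 - ρ * R⁻¹ = (R - ρ) / R := by field_simp
  rw [h2, div_pow]
  refine h1.trans_eq ?_
  field_simp

/-- The Fourier transform of an even real function is its cosine transform. -/
lemma fourier_ofReal_of_even {F : V → ℝ} (hF : Integrable F) (heven : ∀ x, F (-x) = F x) (w : V) :
    𝓕 (fun x => (F x : ℂ)) w = ((∫ x, F x * Real.cos ⟪(2 * Real.pi) • w, x⟫ : ℝ) : ℂ) := by
  have hcos : Integrable fun x => F x * Real.cos ⟪(2 * Real.pi) • w, x⟫ :=
    hF.mul_bdd (c := 1) (Continuous.aestronglyMeasurable (by fun_prop))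
      (Eventually.of_forall fun x => Real.abs_cos_le_one _)
  have hsin : Integrable fun x => F x * Real.sin ⟪(2 * Real.pi) • w, x⟫ :=
    hF.mul_bdd (c := 1) (Continuous.aestronglyMeasurable (by fun_prop))
      (Eventually.of_forall fun x => Real.abs_sin_le_one _)
  have hodd : ∫ x, F x * Real.sin ⟪(2 * Real.pi) • w, x⟫ = 0 := by
    have := integral_neg_eq_self (fun x => F x * Real.sin ⟪(2 * Real.pi) • w, x⟫) volume
    simp only [heven, inner_neg_right, Real.sin_neg, mul_neg, integral_neg] at this
    linarith
  rw [Real.fourier_eq', ← integral_complex_ofReal]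
  have hpt : ∀ x, Complex.exp (↑(-2 * Real.pi * ⟪x, w⟫) * Complex.I) • (F x : ℂ) =
      ((F x * Real.cos ⟪(2 * Real.pi) • w, x⟫ : ℝ) : ℂ) -
        Complex.I * ((F x * Real.sin ⟪(2 * Real.pi) • w, x⟫ : ℝ) : ℂ) := by
    intro x
    rw [real_inner_smul_left, real_inner_comm,
      show -2 * Real.pi * ⟪w, x⟫ = -(2 * Real.pi * ⟪w, x⟫) by ring, Complex.exp_mul_I,
      ← Complex.ofReal_cos, ← Complex.ofReal_sin, Real.cos_neg, Real.sin_neg, smul_eq_mul]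
    push_cast
    ring
  simp_rw [hpt]
  rw [integral_sub hcos.ofReal (hsin.ofReal.const_mul _), integral_const_mul,
    integral_complex_ofReal (f := fun x => F x * Real.sin _), hodd]
  simp

/-- Gaussian summability of the Fourier inversion formula, at points of continuity. -/
lemma tendsto_integral_gaussian_mul_fourier {F : V → ℂ} (hF : Integrable F) {v : V}
    (hv : ContinuousAt F v) :
    Tendsto (fun c : ℝ => ∫ w : V,
      Complex.exp (-(c : ℂ)⁻¹ * ‖w‖ ^ 2 + 2 * Real.pi * Complex.I * ⟪v, w⟫) • 𝓕 F w) atTop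
      (𝓝 (F v)) := by
  refine (Real.tendsto_integral_gaussian_smul' hF hv).congr' ?_
  filter_upwards [Ioi_mem_atTop 0] with c (hc : 0 < c)
  have hc' : 0 < ((c : ℂ)⁻¹).re := by
    rw [← Complex.ofReal_inv, Complex.ofReal_re]
    positivity
  have J : Integrable fun w : V =>
      Complex.exp (-(c : ℂ)⁻¹ * ‖w‖ ^ 2 + 2 * Real.pi * Complex.I * ⟪v, w⟫) :=
    GaussianFourier.integrable_cexp_neg_mul_sq_norm_add hc' _ _
  have key : ∫ w : V, 𝓕 (fun w : V =>
      Complex.exp (-(c : ℂ)⁻¹ * ‖w‖ ^ 2 + 2 * Real.pi * Complex.I * ⟪v, w⟫)) w • F w =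
      ∫ w : V, Complex.exp (-(c : ℂ)⁻¹ * ‖w‖ ^ 2 + 2 * Real.pi * Complex.I * ⟪v, w⟫) • 𝓕 F w := by
    simpa using! VectorFourier.integral_fourierIntegral_smul_eq_flip (L := innerₗ V)
      Real.continuous_fourierChar continuous_inner J hF
  rw [← key]
  congr with w
  rw [fourier_gaussian_innerProductSpace' hc', div_inv_eq_mul, div_inv_eq_mul,
    mul_right_comm (-(Real.pi : ℂ) ^ 2)]

/-- A continuous integrable function with nonnegative Fourier transform is positive definite. -/
lemma posDefFun_of_fourier_nonneg {F : V → ℂ} (hF : Integrable F) (hc : Continuous F)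
    {G : V → ℝ} (hG : ∀ w, 𝓕 F w = G w) (hpos : ∀ᵐ w, 0 ≤ G w) : PosDefFun F := by
  intro N x a
  have hlim : Tendsto (fun c : ℝ => ∑ i, ∑ j, a i * conj (a j) * ∫ w : V,
      Complex.exp (-(c : ℂ)⁻¹ * ‖w‖ ^ 2 + 2 * Real.pi * Complex.I * ⟪x i - x j, w⟫) • 𝓕 F w) atTop
      (𝓝 (∑ i, ∑ j, a i * conj (a j) * F (x i - x j))) :=
    tendsto_finsetSum _ fun i _ => tendsto_finsetSum _ fun j _ =>
      (tendsto_integral_gaussian_mul_fourier hF hc.continuousAt).const_mul _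
  refine ge_of_tendsto hlim ?_
  filter_upwards [Ioi_mem_atTop 0] with c (hc0 : 0 < c)
  have hc' : 0 < ((c : ℂ)⁻¹).re := by
    rw [← Complex.ofReal_inv, Complex.ofReal_re]
    positivity
  have hFcont : Continuous (𝓕 F) :=
    VectorFourier.fourierIntegral_continuous Real.continuous_fourierChar
      (L := innerₗ V) continuous_inner hF
  have hint : ∀ i j, Integrable fun w : V => a i * conj (a j) *
      (Complex.exp (-(c : ℂ)⁻¹ * ‖w‖ ^ 2 + 2 * Real.pi * Complex.I * ⟪x i - x j, w⟫) • 𝓕 F w) :=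
    fun i j => ((GaussianFourier.integrable_cexp_neg_mul_sq_norm_add hc' _ _).mul_bdd
      (c := ∫ v, ‖F v‖) hFcont.aestronglyMeasurable (Eventually.of_forall fun w =>
        VectorFourier.norm_fourierIntegral_le_integral_norm _ _ _ _ w)).const_mul _
  -- the quadratic form is the integral of a squared modulus against the Gaussian and `G`
  have hpt : ∀ w : V, ∑ i, ∑ j, a i * conj (a j) *
      (Complex.exp (-(c : ℂ)⁻¹ * ‖w‖ ^ 2 + 2 * Real.pi * Complex.I * ⟪x i - x j, w⟫) • 𝓕 F w) =
      ((Complex.normSq (∑ i, a i * Complex.exp (2 * Real.pi * Complex.I * ⟪x i, w⟫)) *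
        Real.exp (-c⁻¹ * ‖w‖ ^ 2) * G w : ℝ) : ℂ) := by
    intro w
    rw [Complex.ofReal_mul, Complex.ofReal_mul, Complex.normSq_eq_conj_mul_self, map_sum,
      Finset.sum_mul_sum, Finset.sum_comm, Finset.sum_mul, Finset.sum_mul]
    refine Finset.sum_congr rfl fun j _ => ?_
    rw [Finset.sum_mul, Finset.sum_mul]
    refine Finset.sum_congr rfl fun i _ => ?_
    rw [hG, map_mul, ← Complex.exp_conj, smul_eq_mul, Complex.exp_add, inner_sub_left]
    simp only [map_mul, Complex.conj_I, Complex.conj_ofReal, map_ofNat]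
    push_cast
    rw [show 2 * (Real.pi : ℂ) * Complex.I * (⟪x i, w⟫ - ⟪x j, w⟫) =
      2 * Real.pi * Complex.I * ⟪x i, w⟫ + 2 * Real.pi * -Complex.I * ⟪x j, w⟫ by ring,
      Complex.exp_add]
    ring
  simp_rw [← integral_const_mul]
  simp_rw [← integral_finsetSum _ fun j _ => hint _ j]
  rw [← integral_finsetSum _ fun i _ => integrable_finsetSum _ fun j _ => hint i j]
  simp_rw [hpt]
  rw [integral_complex_ofReal, Complex.zero_le_real]
  refine integral_nonneg_of_ae (hpos.mono fun w hw => ?_)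
  have := Complex.normSq_nonneg (∑ i, a i * Complex.exp (2 * Real.pi * Complex.I * ⟪x i, w⟫))
  simp only [Pi.zero_apply]
  positivity

/-- A continuous compactly supported real positive definite function has nonnegative cosine
transform. -/
lemma integral_mul_cos_nonneg_of_posDefFun [Nontrivial V] {F : V → ℝ} (hc : Continuous F)
    (hs : HasCompactSupport F) (hpos : PosDefFun fun x => (F x : ℂ)) (w : V) :
    0 ≤ ∫ x, F x * Real.cos ⟪w, x⟫ := by
  refine integral_nonneg_of_sum_sub_nonneg (by fun_prop) hs.mul_right fun N x => ?_
  -- the characters `exp (i ⟪w, x i⟫)` as coefficients turn `F` into `F` times a cosine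
  have h1 := (Complex.le_def.1 (hpos N x fun i => Complex.exp (⟪w, x i⟫ * Complex.I))).1
  rw [Complex.zero_re, Complex.re_sum] at h1
  refine h1.trans_eq (Finset.sum_congr rfl fun i _ => ?_)
  rw [Complex.re_sum]
  refine Finset.sum_congr rfl fun j _ => ?_
  rw [← Complex.exp_conj, ← Complex.exp_add, map_mul, Complex.conj_ofReal, Complex.conj_I,
    show (⟪w, x i⟫ : ℂ) * Complex.I + ⟪w, x j⟫ * -Complex.I =
      ((⟪w, x i - x j⟫ : ℝ) : ℂ) * Complex.I by rw [inner_sub_right]; push_cast; ring,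
    Complex.re_mul_ofReal, Complex.exp_ofReal_mul_I_re, mul_comm]

end

/-- Bochner's theorem for radial functions with compact support: membership in `Φ_m` is
nonnegativity of the Hankel transform. -/
lemma phi_iff_hankel_nonneg {m : ℕ} (hm : 1 ≤ m) {φ : ℝ → ℝ} (hc : Continuous φ)
    (hs : HasCompactSupport φ) :
    Phi m φ ↔ ∀ t : ℝ, 0 < t → 0 ≤ hankel m φ t := by
  have : Nonempty (Fin m) := ⟨⟨0, hm⟩⟩
  have hfin : Module.finrank ℝ (EuclideanSpace ℝ (Fin m)) = m := by simp
  have hnt : Nontrivial (EuclideanSpace ℝ (Fin m)) :=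
    Module.nontrivial_of_finrank_pos (R := ℝ) (by rw [hfin]; exact hm)
  have hcn : Continuous fun x : EuclideanSpace ℝ (Fin m) => φ ‖x‖ := hc.comp continuous_norm
  have hsn : HasCompactSupport fun x : EuclideanSpace ℝ (Fin m) => φ ‖x‖ := by
    obtain ⟨R, hR⟩ := hs.isCompact.isBounded.subset_closedBall 0
    refine HasCompactSupport.of_support_subset_isCompact (isCompact_closedBall 0 R) fun x hx => ?_
    have := hR (subset_tsupport φ hx)
    simpa using this
  have hint := hcn.integrable_of_hasCompactSupport hsn (μ := volume)
  have hK : 0 < (2 * Real.pi) ^ ((m : ℝ) / 2) := by positivity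
  have hrad := fun w => integral_radial_mul_cos hint w
  rw [hfin] at hrad
  constructor
  · rintro ⟨-, hpd⟩ t ht
    obtain ⟨w, hw⟩ := exists_norm_eq (EuclideanSpace ℝ (Fin m)) ht.le
    have := integral_mul_cos_nonneg_of_posDefFun hcn hsn hpd w
    rw [hrad, hw] at this
    exact nonneg_of_mul_nonneg_right this hK
  · intro H
    refine ⟨hc.continuousOn, ?_⟩
    refine posDefFun_of_fourier_nonneg hint.ofReal (Complex.continuous_ofReal.comp hcn)
      (fun w => fourier_ofReal_of_even hint (fun x => by rw [norm_neg]) w) ?_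
    have h0 : ∀ᵐ w : EuclideanSpace ℝ (Fin m), w ≠ 0 := by
      simp [ae_iff]
    filter_upwards [h0] with w hw
    rw [hrad]
    refine mul_nonneg hK.le (H _ ?_)
    rw [norm_pos_iff]
    exact smul_ne_zero (by positivity) hw

/-! ### The chain of equivalences -/

lemma completelyMonotone_congr {u v : ℝ → ℝ} (huv : EqOn u v (Ioi 0)) :
    CompletelyMonotone u ↔ CompletelyMonotone v := by
  have h1 : ∀ (k : ℕ) (x : ℝ), 0 < x → iteratedDeriv k u x = iteratedDeriv k v x := by
    intro k x hx
    have : u =ᶠ[𝓝 x] v := by filter_upwards [Ioi_mem_nhds hx] with y hy using huv hy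
    exact this.iteratedDeriv_eq k
  unfold CompletelyMonotone
  rw [contDiffOn_congr huv]
  refine and_congr_right fun _ => forall_congr' fun k => forall_congr' fun x =>
    forall_congr' fun hx => ?_
  rw [h1 k x hx]

lemma completelyMonotone_const_mul_iff {u : ℝ → ℝ} {K : ℝ} (hK : 0 < K) :
    CompletelyMonotone (fun x => K * u x) ↔ CompletelyMonotone u := by
  have key : ∀ (w : ℝ → ℝ) (c : ℝ), 0 < c → CompletelyMonotone w →
      CompletelyMonotone fun x => c * w x := by
    intro w c hc hw
    refine ⟨contDiffOn_const.mul hw.1, fun k x hx => ?_⟩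
    rw [iteratedDeriv_const_mul_field, mul_left_comm]
    exact mul_nonneg hc.le (hw.2 k x hx)
  refine ⟨fun H => ?_, key u K hK⟩
  have := key _ K⁻¹ (by positivity) H
  simpa [← mul_assoc, inv_mul_cancel₀ hK.ne'] using this

lemma hankel_scaled_h (m : ℕ) (μ ν ε : ℝ) {β : ℝ} (hβ : 0 < β) (t : ℝ) :
    ∫ u in Ioi (0 : ℝ), β ^ ε * h μ ν (u / β) * u ^ ((m : ℝ) - 1) *
      besselj ((m : ℝ) / 2 - 1) (t * u) =
    β ^ (ε + m) * hankel m (h μ ν) (β * t) := by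
  have h1 := integral_comp_mul_left_Ioi (fun u : ℝ => β ^ ε * h μ ν (u / β) * u ^ ((m : ℝ) - 1) *
      besselj ((m : ℝ) / 2 - 1) (t * u)) 0 hβ
  rw [mul_zero, smul_eq_mul, inv_mul_eq_div, eq_div_iff hβ.ne'] at h1
  rw [← h1, hankel, ← integral_mul_const, ← integral_const_mul]
  refine setIntegral_congr_fun measurableSet_Ioi fun u (hu : 0 < u) => ?_
  rw [mul_div_cancel_left₀ _ hβ.ne', Real.mul_rpow hβ.le hu.le,
    show ε + (m : ℝ) = ε + ((m : ℝ) - 1) + 1 by ring, Real.rpow_add hβ, Real.rpow_add hβ,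
    Real.rpow_one, mul_left_comm t β u, mul_assoc β t u]
  ring

lemma continuous_scaled_h {μ ν : ℝ} (hμ : 0 < μ) (hν : 1 / 2 < ν) (hμν : 1 < μ + ν) (β : ℝ) :
    Continuous fun u : ℝ => h μ ν (u / β) :=
  (continuous_h hμ hν hμν).comp (continuous_id.div_const β)

lemma hasCompactSupport_scaled_h (μ ν : ℝ) {β : ℝ} (hβ : 0 < β) :
    HasCompactSupport fun u : ℝ => h μ ν (u / β) := by
  have := (hasCompactSupport_h μ ν).comp_homeomorph (Homeomorph.mulRight₀ β⁻¹ (by positivity))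
  simpa [Function.comp_def, div_eq_mul_inv] using this

lemma hankel_f {m : ℕ} (hm : 1 ≤ m) {μ ν : ℝ} (hμ : 0 < μ) (hν : 1 / 2 < ν) (hμν : 1 < μ + ν)
    (ε : ℝ) {β₁ β₂ : ℝ} (hβ₁ : 0 < β₁) (hβ₂ : 0 < β₂) (t : ℝ) :
    hankel m (f μ ν ε β₁ β₂) t =
      β₂ ^ (ε + m) * hankel m (h μ ν) (β₂ * t) - β₁ ^ (ε + m) * hankel m (h μ ν) (β₁ * t) := by
  have hm1 : (1 : ℝ) ≤ m := by exact_mod_cast hm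
  have hint : ∀ β : ℝ, 0 < β → Integrable fun u : ℝ => β ^ ε * h μ ν (u / β) * u ^ ((m : ℝ) - 1) *
      besselj ((m : ℝ) / 2 - 1) (t * u) := by
    intro β hβ
    have hp := Real.continuous_rpow_const (q := (m : ℝ) - 1) (by linarith)
    have hj := (continuous_besselj (l := (m : ℝ) / 2 - 1) (by linarith)).comp
      (continuous_const.mul continuous_id : Continuous fun u : ℝ => t * u)
    have hh := continuous_scaled_h hμ hν hμν β
    refine Continuous.integrable_of_hasCompactSupport
      (((continuous_const.mul hh).mul hp).mul hj) ?_
    exact ((hasCompactSupport_scaled_h μ ν hβ).mul_left.mul_right).mul_right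
  rw [← hankel_scaled_h m μ ν ε hβ₂ t, ← hankel_scaled_h m μ ν ε hβ₁ t, hankel,
    ← integral_sub (hint β₂ hβ₂).integrableOn (hint β₁ hβ₁).integrableOn]
  congr 1
  ext u
  rw [f]
  ring

/-- Positive definiteness of all the differences `f` is monotonicity of `t^{ε+m} 𝔉_m(h)(t)`. -/
lemma phi_f_iff {m : ℕ} (hm : 1 ≤ m) {μ ν : ℝ} (hμ : 0 < μ) (hν : 1 / 2 < ν) (hμν : 1 < μ + ν)
    (ε : ℝ) {β₁ β₂ : ℝ} (hβ₁ : 0 < β₁) (hβ₂ : 0 < β₂) :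
    Phi m (f μ ν ε β₁ β₂) ↔ ∀ t : ℝ, 0 < t →
      0 ≤ β₂ ^ (ε + m) * hankel m (h μ ν) (β₂ * t)
        - β₁ ^ (ε + m) * hankel m (h μ ν) (β₁ * t) := by
  have hc : Continuous (f μ ν ε β₁ β₂) :=
    (continuous_const.mul (continuous_scaled_h hμ hν hμν β₂)).sub
      (continuous_const.mul (continuous_scaled_h hμ hν hμν β₁))
  have hs : HasCompactSupport (f μ ν ε β₁ β₂) := by
    have := ((hasCompactSupport_scaled_h μ ν hβ₂).mul_left (f := fun _ => β₂ ^ ε)).sub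
      ((hasCompactSupport_scaled_h μ ν hβ₁).mul_left (f := fun _ => β₁ ^ ε))
    exact this
  rw [phi_iff_hankel_nonneg hm hc hs]
  simp_rw [hankel_f hm hμ hν hμν ε hβ₁ hβ₂]

/-- Comparing dilates of `F` at arbitrary scales is monotonicity of `t^a F(t)`. -/
lemma forall_dilate_le_iff_monotoneOn (F : ℝ → ℝ) (a : ℝ) :
    (∀ β₁ β₂ : ℝ, 0 < β₁ → β₁ < β₂ → ∀ t : ℝ, 0 < t →
      0 ≤ β₂ ^ a * F (β₂ * t) - β₁ ^ a * F (β₁ * t)) ↔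
    MonotoneOn (fun t : ℝ => t ^ a * F t) (Ioi 0) := by
  constructor
  · intro H s hs t ht hst
    rcases hst.eq_or_lt with rfl | hlt
    · exact le_rfl
    · have := H s t hs hlt 1 one_pos
      simp only [mul_one] at this
      simp only
      linarith
  · intro H β₁ β₂ h1 h12 t ht
    have h2 : 0 < β₂ := h1.trans h12
    have := H (mul_pos h1 ht) (mul_pos h2 ht) (mul_le_mul_of_nonneg_right h12.le ht.le)
    simp only [Real.mul_rpow h1.le ht.le, Real.mul_rpow h2.le ht.le] at this
    have h3 : 0 ≤ t ^ a * (β₂ ^ a * F (β₂ * t) - β₁ ^ a * F (β₁ * t)) := by linarith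
    exact nonneg_of_mul_nonneg_right h3 (by positivity)

/-- Differentiating `t^a F(t)` and dividing by `t^(a-1)`. -/
lemma monotoneOn_rpow_mul_iff {F F' : ℝ → ℝ} (hF : ∀ t, 0 < t → HasDerivAt F (F' t) t) (a : ℝ) :
    MonotoneOn (fun t : ℝ => t ^ a * F t) (Ioi 0) ↔ ∀ t, 0 < t → 0 ≤ a * F t + t * F' t := by
  have hd : ∀ t, 0 < t → HasDerivAt (fun t : ℝ => t ^ a * F t)
      (t ^ (a - 1) * (a * F t + t * F' t)) t := by
    intro t ht
    convert! (Real.hasDerivAt_rpow_const (p := a) (Or.inl ht.ne')).mul (hF t ht) using 1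
    have : t ^ a = t ^ (a - 1) * t := by
      rw [← Real.rpow_add_one ht.ne', sub_add_cancel]
    rw [this]
    ring
  constructor
  · intro H t ht
    have h1 : 0 ≤ derivWithin (fun t : ℝ => t ^ a * F t) (Ioi 0) t := H.derivWithin_nonneg
    rw [(hd t ht).hasDerivWithinAt.derivWithin (isOpen_Ioi.uniqueDiffWithinAt ht)] at h1
    exact nonneg_of_mul_nonneg_right h1 (by positivity)
  · intro H
    refine monotoneOn_of_deriv_nonneg (convex_Ioi 0)
      (fun t ht => (hd t ht).continuousAt.continuousWithinAt) ?_ ?_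
    · rw [interior_Ioi]
      exact fun t ht => (hd t ht).differentiableAt.differentiableWithinAt
    · rw [interior_Ioi]
      intro t (ht : 0 < t)
      rw [(hd t ht).deriv]
      exact mul_nonneg (by positivity) (H t ht)

/-- The function whose Laplace transform appears in the complete monotonicity condition splits
into two weighted Fourier transforms. -/
lemma laplace_integrand_eq {μ n a : ℝ} {t : ℝ} (ht : 0 < t) :
    t ^ (2 * n + μ - 1) * (a * hHat μ n t - t ^ 2 / (2 * n) * hHat μ (n + 1) t) =
      a * (t ^ (2 * n + μ - 1) * hHat μ n t) -
        1 / (2 * n) * (t ^ (2 * (n + 1) + μ - 1) * hHat μ (n + 1) t) := by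
  rw [show 2 * (n + 1) + μ - 1 = 2 * n + μ - 1 + 2 by ring, Real.rpow_add ht, Real.rpow_two]
  ring

lemma integrableOn_laplace_integrand {μ n : ℝ} (hμ : 0 < μ) (hn : 1 / 2 < n) (hμn : 1 < μ + n)
    (a : ℝ) {x : ℝ} (hx : 0 < x) :
    IntegrableOn (fun t : ℝ => Real.exp (-(t * x)) * (t ^ (2 * n + μ - 1) *
      (a * hHat μ n t - t ^ 2 / (2 * n) * hHat μ (n + 1) t))) (Ioi 0) := by
  have h1 := (integrableOn_exp_mul_rpow_mul_hHat hμ hn hμn hx).const_mul a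
  have h2 := (integrableOn_exp_mul_rpow_mul_hHat hμ (ν := n + 1) (by linarith) (by linarith)
    hx).const_mul (1 / (2 * n))
  refine (h1.sub h2).congr ((ae_restrict_mem measurableSet_Ioi).mono fun t ht => ?_)
  simp only [Pi.sub_apply]
  rw [laplace_integrand_eq ht]
  ring

lemma laplace_closed_form {μ n : ℝ} (hμ : 0 < μ) (hn : 1 / 2 < n) (hμn : 1 < μ + n)
    (a : ℝ) {x : ℝ} (hx : 0 < x) :
    laplace (fun t : ℝ => t ^ (2 * n + μ - 1) *
      (a * hHat μ n t - t ^ 2 / (2 * n) * hHat μ (n + 1) t)) x =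
      Real.Gamma n ^ 2 * Real.Gamma μ * 2 ^ (2 * n - 1) *
        (a / (x ^ μ * (1 + x ^ 2) ^ n) - 2 * n / (x ^ μ * (1 + x ^ 2) ^ (n + 1))) := by
  have h1 := (integrableOn_exp_mul_rpow_mul_hHat hμ hn hμn hx).const_mul a
  have h2 := (integrableOn_exp_mul_rpow_mul_hHat hμ (ν := n + 1) (by linarith) (by linarith)
    hx).const_mul (1 / (2 * n))
  have e1 := laplace_rpow_mul_hHat hμ hn hμn hx
  have e2 := laplace_rpow_mul_hHat hμ (ν := n + 1) (by linarith) (by linarith) hx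
  have h3 : laplace (fun t : ℝ => t ^ (2 * n + μ - 1) *
      (a * hHat μ n t - t ^ 2 / (2 * n) * hHat μ (n + 1) t)) x =
      a * laplace (fun t => t ^ (2 * n + μ - 1) * hHat μ n t) x -
        1 / (2 * n) * laplace (fun t => t ^ (2 * (n + 1) + μ - 1) * hHat μ (n + 1) t) x := by
    simp only [laplace]
    rw [← integral_const_mul, ← integral_const_mul, ← integral_sub h1 h2]
    refine setIntegral_congr_fun measurableSet_Ioi fun t ht => ?_
    rw [laplace_integrand_eq ht]
    ring
  have hn0 : n ≠ 0 := by linarith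
  have hx1 : (1 + x ^ 2) ^ n ≠ 0 := by positivity
  have hx2 : x ^ μ ≠ 0 := by positivity
  have hx3 : 1 + x ^ 2 ≠ 0 := by positivity
  rw [h3, e1, e2, Real.Gamma_add_one hn0, show 2 * (n + 1) - 1 = 2 * n - 1 + 2 by ring,
    Real.rpow_add two_pos, Real.rpow_two, Real.rpow_add_one hx3]
  field_simp

/-- A combination of Fourier transforms is nonnegative exactly when its weighted Laplace transform
is completely monotone. -/
lemma completelyMonotone_laplace_hHat_iff {μ n : ℝ} (hμ : 0 < μ) (hn : 1 / 2 < n)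
    (hμn : 1 < μ + n) (a : ℝ) :
    CompletelyMonotone (laplace (fun t : ℝ => t ^ (2 * n + μ - 1) *
      (a * hHat μ n t - t ^ 2 / (2 * n) * hHat μ (n + 1) t))) ↔
    ∀ t : ℝ, 0 < t → 0 ≤ a * hHat μ n t - t ^ 2 / (2 * n) * hHat μ (n + 1) t := by
  rw [completelyMonotone_laplace_iff fun x hx => integrableOn_laplace_integrand hμ hn hμn a hx]
  constructor
  · intro H t ht
    set p := 2 * n + μ - 1 with hp
    set C₁ := ∫ x : ℝ, ‖h μ n x‖
    set C₂ := ∫ x : ℝ, ‖h μ (n + 1) x‖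
    have hC₁ : 0 ≤ C₁ := integral_nonneg fun _ => norm_nonneg _
    have hC₂ : 0 ≤ C₂ := integral_nonneg fun _ => norm_nonneg _
    have hc : ContinuousOn (fun t : ℝ => t ^ p *
        (a * hHat μ n t - t ^ 2 / (2 * n) * hHat μ (n + 1) t)) (Ioi 0) := by
      have h1 := continuous_hHat hμ hn hμn
      have h2 := continuous_hHat hμ (ν := n + 1) (by linarith) (by linarith)
      have h3 := Real.continuous_rpow_const (q := p) (by linarith)
      exact Continuous.continuousOn (by fun_prop)
    -- a power of `t` with exponent in `[0, M]` is at most `1 + t ^ M`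
    obtain ⟨M, hM⟩ := exists_nat_ge (p + 2)
    have hpow : ∀ q : ℝ, 0 ≤ q → q ≤ M → ∀ s : ℝ, 0 < s → s ^ q ≤ 1 + s ^ M := by
      intro q hq0 hqM s hs
      rcases le_total s 1 with h1 | h1
      · have := Real.rpow_le_one hs.le h1 hq0
        have : 0 ≤ s ^ M := by positivity
        linarith
      · have := Real.rpow_le_rpow_of_exponent_le h1 hqM
        rw [Real.rpow_natCast] at this
        linarith
    have hb : ∀ s : ℝ, 0 < s → |s ^ p * (a * hHat μ n s - s ^ 2 / (2 * n) * hHat μ (n + 1) s)| ≤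
        (|a| * C₁ + 1 / (2 * n) * C₂) * (1 + s ^ M) := by
      intro s hs
      have hn0 : 0 < n := by linarith
      rw [laplace_integrand_eq hs]
      refine (abs_sub _ _).trans ?_
      rw [abs_mul, abs_mul, abs_mul, abs_mul, abs_of_nonneg (show 0 ≤ 1 / (2 * n) by positivity),
        abs_of_nonneg (Real.rpow_nonneg hs.le _), abs_of_nonneg (Real.rpow_nonneg hs.le _), add_mul,
        mul_assoc, mul_assoc, mul_comm C₁, mul_comm C₂]
      have b1 := abs_hHat_le hμ hn hμn s
      have b2 := abs_hHat_le hμ (ν := n + 1) (by linarith) (by linarith) s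
      have b3 := hpow p (by linarith) (by linarith) s hs
      have b4 := hpow (2 * (n + 1) + μ - 1) (by linarith) (by linarith) s hs
      gcongr
    have := nonneg_of_laplace_moments_nonneg hc hb
      (fun x hx => integrableOn_laplace_integrand hμ hn hμn a hx) H ht
    exact nonneg_of_mul_nonneg_right this (by positivity)
  · intro H k x hx
    refine setIntegral_nonneg measurableSet_Ioi fun t (ht : 0 < t) => ?_
    have := H t ht
    positivity

end Buhmann

theorem proposition1 (ε μ ν : ℝ) (m : ℕ) (hε : 0 < ε) (hμ : 0 < μ) (hν : 1 / 2 < ν)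
    (hμν : 1 < μ + ν) (hm : 1 ≤ m) (n : ℝ) (hn : n = ((m : ℝ) - 1) / 2 + ν) :
    -- the Hankel transform in terms of `I`
    (∀ t : ℝ, 0 < t →
      t ^ (ε + m) * Buhmann.hankel m (Buhmann.h μ ν) t =
        2 ^ (ν - 1) * Real.Gamma ν * t ^ (ε + m) *
          Buhmann.I 1 μ (((m : ℝ) - 1) / 2 + ν) ((m : ℝ) - 1 + 2 * ν - 1) t) ∧
    -- the two forms of the differential inequality agree, with the differentiability that it presupposes
    (∀ t : ℝ, 0 < t →
      DifferentiableAt ℝ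
        (Buhmann.I 1 μ (((m : ℝ) - 1) / 2 + ν) ((m : ℝ) - 1 + 2 * ν - 1)) t ∧
      (ε + m) * Buhmann.I 1 μ (((m : ℝ) - 1) / 2 + ν) ((m : ℝ) - 1 + 2 * ν - 1) t
        + t * deriv (Buhmann.I 1 μ (((m : ℝ) - 1) / 2 + ν) ((m : ℝ) - 1 + 2 * ν - 1)) t =
      (ε + m) * Buhmann.I 1 μ (((m : ℝ) - 1) / 2 + ν) ((m : ℝ) - 1 + 2 * ν - 1) t
        - t ^ 2 * Buhmann.I 1 μ (((m : ℝ) - 1) / 2 + ν + 1) ((m : ℝ) - 1 + 2 * ν + 1) t) ∧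
    -- the Laplace transform in closed form, with the convergence that it presupposes
    (∀ x : ℝ, 0 < x →
      IntegrableOn (fun t : ℝ => Real.exp (-(t * x)) * (t ^ (2 * n + μ - 1) *
        ((ε + m) * Buhmann.hHat μ n t - t ^ 2 / (2 * n) * Buhmann.hHat μ (n + 1) t))) (Ioi 0) ∧
      Buhmann.laplace (fun t : ℝ => t ^ (2 * n + μ - 1) *
        ((ε + m) * Buhmann.hHat μ n t - t ^ 2 / (2 * n) * Buhmann.hHat μ (n + 1) t)) x =
      Real.Gamma n ^ 2 * Real.Gamma μ * 2 ^ (2 * n - 1) *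
        ((ε + m) / (x ^ μ * (1 + x ^ 2) ^ n) - 2 * n / (x ^ μ * (1 + x ^ 2) ^ (n + 1)))) ∧
    -- the equivalence of the seven conditions
    List.TFAE [
      ∀ β₁ β₂ : ℝ, 0 < β₁ → β₁ < β₂ → Buhmann.Phi m (Buhmann.f μ ν ε β₁ β₂),
      ∀ β₁ β₂ : ℝ, 0 < β₁ → β₁ < β₂ → ∀ t : ℝ, 0 < t →
        0 ≤ β₂ ^ (ε + m) * Buhmann.hankel m (Buhmann.h μ ν) (β₂ * t)
          - β₁ ^ (ε + m) * Buhmann.hankel m (Buhmann.h μ ν) (β₁ * t),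
      MonotoneOn (fun t : ℝ => t ^ (ε + m) * Buhmann.hankel m (Buhmann.h μ ν) t) (Ioi 0),
      ∀ t : ℝ, 0 < t →
        0 ≤ (ε + m) * Buhmann.I 1 μ (((m : ℝ) - 1) / 2 + ν) ((m : ℝ) - 1 + 2 * ν - 1) t
          + t * deriv (Buhmann.I 1 μ (((m : ℝ) - 1) / 2 + ν) ((m : ℝ) - 1 + 2 * ν - 1)) t,
      ∀ t : ℝ, 0 < t →
        0 ≤ (ε + m) * Buhmann.hankel 1 (Buhmann.h μ n) t
          - t ^ 2 / (2 * n) * Buhmann.hankel 1 (Buhmann.h μ (n + 1)) t,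
      Buhmann.CompletelyMonotone (Buhmann.laplace (fun t : ℝ => t ^ (2 * n + μ - 1) *
        ((ε + m) * Buhmann.hHat μ n t - t ^ 2 / (2 * n) * Buhmann.hHat μ (n + 1) t))),
      Buhmann.CompletelyMonotone (fun x : ℝ =>
        (ε - 2 * ν + 1 + (ε + m) * x ^ 2) /
          (x ^ μ * (1 + x ^ 2) ^ (((m : ℝ) - 1) / 2 + ν + 1)))] := by
  have hm1 : (1 : ℝ) ≤ m := by exact_mod_cast hm
  have hn2 : 1 / 2 < n := by rw [hn]; linarith
  have hn0 : 0 < n := by linarith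
  have hμn : 1 < μ + n := by rw [hn]; linarith
  have e1 : (m : ℝ) - 1 + 2 * ν - 1 = 2 * n - 1 := by rw [hn]; ring
  have e2 : (m : ℝ) - 1 + 2 * ν + 1 = 2 * n + 1 := by rw [hn]; ring
  rw [e1, e2, ← hn]
  have hhankel : ∀ t, Buhmann.hankel m (Buhmann.h μ ν) t =
      2 ^ (ν - 1) * Real.Gamma ν * Buhmann.I 1 μ n (2 * n - 1) t := by
    intro t
    rw [Buhmann.hankel_h_eq hm1 hμ hν hμν, e1, ← hn]
  have hderiv : ∀ t, HasDerivAt (Buhmann.I 1 μ n (2 * n - 1))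
      (-t * Buhmann.I 1 μ (n + 1) (2 * n + 1) t) t := by
    intro t
    have := Buhmann.hasDerivAt_I (μ := μ) (ν := n) (α := 2 * n - 1) hμ (by linarith)
      (by linarith) t
    rwa [show 2 * n - 1 + 2 = 2 * n + 1 by ring] at this
  have hder : ∀ t, (ε + m) * Buhmann.I 1 μ n (2 * n - 1) t +
      t * deriv (Buhmann.I 1 μ n (2 * n - 1)) t = (ε + m) * Buhmann.I 1 μ n (2 * n - 1) t -
        t ^ 2 * Buhmann.I 1 μ (n + 1) (2 * n + 1) t := by
    intro t
    rw [(hderiv t).deriv]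
    ring
  refine ⟨fun t _ => by rw [hhankel]; ring, fun t _ => ⟨(hderiv t).differentiableAt, hder t⟩,
    fun x hx => ⟨Buhmann.integrableOn_laplace_integrand hμ hn2 hμn _ hx,
      Buhmann.laplace_closed_form hμ hn2 hμn _ hx⟩, ?_⟩
  tfae_have 1 ↔ 2 := forall_congr' fun β₁ => forall_congr' fun β₂ => forall_congr' fun h1 =>
    forall_congr' fun h12 => Buhmann.phi_f_iff hm hμ hν hμν ε h1 (h1.trans h12)
  tfae_have 2 ↔ 3 := Buhmann.forall_dilate_le_iff_monotoneOn _ _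
  tfae_have 3 ↔ 4 := by
    have hK : 0 < (2 : ℝ) ^ (ν - 1) * Real.Gamma ν :=
      mul_pos (by positivity) (Real.Gamma_pos_of_pos (by linarith))
    rw [Buhmann.monotoneOn_rpow_mul_iff (F := Buhmann.hankel m (Buhmann.h μ ν))
      (F' := fun t => 2 ^ (ν - 1) * Real.Gamma ν * (-t * Buhmann.I 1 μ (n + 1) (2 * n + 1) t))
      fun t _ => by rw [funext hhankel]; exact (hderiv t).const_mul _]
    refine forall_congr' fun t => forall_congr' fun _ => ?_
    have e : (ε + m) * (2 ^ (ν - 1) * Real.Gamma ν * Buhmann.I 1 μ n (2 * n - 1) t) +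
        t * (2 ^ (ν - 1) * Real.Gamma ν * (-t * Buhmann.I 1 μ (n + 1) (2 * n + 1) t)) =
        2 ^ (ν - 1) * Real.Gamma ν * ((ε + m) * Buhmann.I 1 μ n (2 * n - 1) t +
          t * (-t * Buhmann.I 1 μ (n + 1) (2 * n + 1) t)) := by ring
    rw [hhankel, (hderiv t).deriv, e, mul_nonneg_iff_of_pos_left hK]
  -- the exponents and Gamma functions for `n` and `n + 1` differ by the factor `2 n`, which cancels
  have hhankel1 : ∀ t, (ε + m) * Buhmann.hankel 1 (Buhmann.h μ n) t -
      t ^ 2 / (2 * n) * Buhmann.hankel 1 (Buhmann.h μ (n + 1)) t =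
      2 ^ (n - 1) * Real.Gamma n * ((ε + m) * Buhmann.I 1 μ n (2 * n - 1) t -
        t ^ 2 * Buhmann.I 1 μ (n + 1) (2 * n + 1) t) := by
    intro t
    rw [Buhmann.hankel_h_eq le_rfl hμ hn2 hμn,
      Buhmann.hankel_h_eq le_rfl hμ (ν := n + 1) (by linarith) (by linarith),
      Real.Gamma_add_one hn0.ne', show (1 - 1 : ℝ) / 2 + n = n by ring,
      show (1 - 1 : ℝ) + 2 * n - 1 = 2 * n - 1 by ring,
      show (1 - 1 : ℝ) / 2 + (n + 1) = n + 1 by ring,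
      show (1 - 1 : ℝ) + 2 * (n + 1) - 1 = 2 * n + 1 by ring,
      show n + 1 - 1 = n - 1 + 1 by ring, Real.rpow_add_one two_ne_zero]
    field_simp
  tfae_have 4 ↔ 5 := by
    have hK : 0 < (2 : ℝ) ^ (n - 1) * Real.Gamma n :=
      mul_pos (by positivity) (Real.Gamma_pos_of_pos hn0)
    refine forall_congr' fun t => forall_congr' fun _ => ?_
    rw [hhankel1, mul_nonneg_iff_of_pos_left hK, hder]
  tfae_have 5 ↔ 6 := by
    rw [Buhmann.completelyMonotone_laplace_hHat_iff hμ hn2 hμn]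
    refine forall_congr' fun t => forall_congr' fun _ => ?_
    rw [Buhmann.hHat_eq_hankel hμ hn2 hμn,
      Buhmann.hHat_eq_hankel hμ (ν := n + 1) (by linarith) (by linarith),
      ← mul_nonneg_iff_of_pos_left (show 0 < √2 * √Real.pi by positivity)]
    ring_nf
  tfae_have 6 ↔ 7 := by
    have hK : 0 < Real.Gamma n ^ 2 * Real.Gamma μ * 2 ^ (2 * n - 1) := by
      have := Real.Gamma_pos_of_pos hn0
      have := Real.Gamma_pos_of_pos hμ
      positivity
    rw [← Buhmann.completelyMonotone_const_mul_iff hK (u := fun x : ℝ =>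
      (ε - 2 * ν + 1 + (ε + m) * x ^ 2) / (x ^ μ * (1 + x ^ 2) ^ (n + 1)))]
    refine Buhmann.completelyMonotone_congr fun x (hx : 0 < x) => ?_
    rw [Buhmann.laplace_closed_form hμ hn2 hμn _ hx]
    have hx1 : (1 + x ^ 2) ^ n ≠ 0 := by positivity
    have hx2 : x ^ μ ≠ 0 := by positivity
    have hx3 : 1 + x ^ 2 ≠ 0 := by positivity
    rw [Real.rpow_add_one hx3]
    field_simp
    rw [hn]
    ring
  tfae_finish
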